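/- **Setting.** Let $\mathbb{Y}$ and $\Theta$ be Polish metric spaces with their Borel $\sigma$-algebras, $\ell$ a $\sigma$-finite measure on $\mathbb{Y}$, $H$ a measure on $\Theta$ that is locally finite (finite on bounded sets), $K_\phi:\mathbb{Y}\times\Theta\to[0,\infty)$ a measurable kernel, $\beta_t>0$ and $c_t>0$ for $t\ge 2$, and $\kappa_t\ge 0$ for $t\ge1$. Let $(N_t)_{t\ge 1}$ be an SN-M-ARG(1) process, that is: * $(W_t)_{t\ge1}$ is a sequence of locally finite random measures on $\Theta$ such that for every $t\ge1$ the conditional law of $W_{t+1}$ given $W_1,\dots,W_t$ is that of the noncentral gamma process of parameters $(H,\beta_{t+1}W_t,c_{t+1}^{-1})$: for every nonnegative bounded measurable $f$ with bounded support, almost surely, $$\mathrm{E}\big(e^{-\int f\,\mathrm{d}W_{t+1}}\mid W_1,\dots,W_t\big)=\exp\Big(-\int_\Theta\log(1+c_{t+1}f)\,\mathrm{d}H-\int_\Theta\frac{c_{t+1}f}{1+c_{t+1}f}\,\beta_{t+1}\,\mathrm{d}W_t\Big);$$ * conditionally on $(W_s)_{s\ge1}$, the $N_t$, $t\ge1$,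 are independent Poisson random measures on $\mathbb{Y}$ with mean measures $\kappa_t\lambda_t(y)\,\ell(\mathrm{d}y)$, where $\lambda_t(y)=\int_\Theta K_\phi(y,\theta)\,W_t(\mathrm{d}\theta)$. Assume that $\bar W_1(\cdot)=\mathrm{E}(W_1(\cdot))$ is locally finite and that for all bounded measurable $B,B_1,B_2\subset\mathbb{Y}$: * $(H_1)$ $\int_B K_\phi(y,\theta)\,\ell(\mathrm{d}y)<\infty$ for all $\theta$, and $\int_B\int_\Theta K_\phi(y,\theta)\,[H+\bar W_1](\mathrm{d}\theta)\,\ell(\mathrm{d}y)<\infty$; * $(H_2)$ $\int_{B_1\times B_2}\int_\Theta K_\phi(y_1,\theta)K_\phi(y_2,\theta)\,[H+\bar W_1](\mathrm{d}\theta)\,\ell(\mathrm{d}y_1)\,\ell(\mathrm{d}y_2)<\infty$; * $(H_3)$ $\mathrm{E}\big(\int_{B_1\times B_2}\int_\Theta K_\phi(y_1,\theta_1)W_1(\mathrm{d}\theta_1)\int_\Theta K_\phi(y_2,\theta_2)W_1(\mathrm{d}\theta_2)\,\ell(\mathrm{d}y_1)\,\ell(\mathrm{d}y_2)\big)<\infty$.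 For $s>t\ge1$ put $$\rho_{s|t}=\prod_{j=t+1}^{s}\beta_jc_j,\qquad c_{s|t}=c_s+\sum_{j=t+1}^{s-1}c_j\prod_{i=j+1}^{s}\beta_ic_i,$$ and let $\rho_{t|t}=1$, $c_{t|t}=0$. For $t,h\geq 1$ set $$\mathfrak{D}^{(1)}_t(y)=\kappa_t\mathrm{E}(\lambda_t(y)),\quad \mathfrak{D}^{(2)}_t(y_1,y_2)=\kappa_t^2\,\mathrm{E}(\lambda_t(y_1)\lambda_t(y_2)),\quad \mathfrak{D}^{(2)}_{t,t+h}(y_1,y_2)=\kappa_t\kappa_{t+h}\mathrm{E}(\lambda_t(y_1)\lambda_{t+h}(y_2)),$$ with values in $[0,\infty]$. **Claim.** For all integers $t,h\ge 1$, $\mathfrak{D}^{(1)}_t$, $\mathfrak{D}^{(2)}_t$ and $\mathfrak{D}^{(2)}_{t,t+h}$ are the intensity, the second-order product density and the cross second-order density of the process: they are measurable, and for all bounded measurable $B_1,B_2\subset\mathbb{Y}$, $$\mathrm{E}(N_t(B_1))=\int_{B_1}\mathfrak{D}^{(1)}_t\,\mathrm{d}\ell,\qquad \mathrm{E}(N_t(B_1)N_t(B_2))=\int_{B_1\cap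 B_2}\mathfrak{D}^{(1)}_t\,\mathrm{d}\ell+\int_{B_1\times B_2}\mathfrak{D}^{(2)}_t\,\mathrm{d}(\ell\otimes\ell),$$ $$\mathrm{E}(N_t(B_1)N_{t+h}(B_2))=\int_{B_1\times B_2}\mathfrak{D}^{(2)}_{t,t+h}\,\mathrm{d}(\ell\otimes\ell),$$ all these integrals being finite. Moreover, they have the following closed forms. 1. For every $y\in\mathbb{Y}$, in $[0,\infty]$, $$\mathfrak{D}^{(1)}_t(y)=\kappa_tc_{t|1}\int_\Theta K_\phi(y,\theta)\,H(\mathrm{d}\theta)+\kappa_t\rho_{t|1}\int_\Theta K_\phi(y,\theta)\,\bar W_1(\mathrm{d}\theta).$$ 2. For all $y_1,y_2\in\mathbb{Y}$, in $[0,\infty]$ (with $0\cdot\infty=0$, and the first term read as $0$ if $\kappa_t=0$), $$\mathfrak{D}^{(2)}_{t,t+h}(y_1,y_2)=\frac{\kappa_{t+h}}{\kappa_t}\,\rho_{t+h|t}\,\mathfrak{D}^{(2)}_t(y_1,y_2)+\mathfrak{D}^{(1)}_t(y_1)\,\kappa_{t+h}\,c_{t+h|t}\int_\Theta K_\phi(y_2,\theta)\,H(\mathrm{d}\theta).$$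 3. For all $y_1,y_2\in\mathbb{Y}$ at which $\int_\Theta K_\phi(y_i,\theta)[H+\bar W_1](\mathrm{d}\theta)$ $(i=1,2)$, $\int_\Theta K_\phi(y_1,\theta)K_\phi(y_2,\theta)[H+\bar W_1](\mathrm{d}\theta)$ and $\mathrm{E}(\lambda_1(y_1)\lambda_1(y_2))$ are finite, which is the case for $\ell\otimes\ell$-almost every $(y_1,y_2)$, the numbers $\mathfrak{D}^{(1)}_t(y_1)$, $\mathfrak{D}^{(1)}_t(y_2)$, $\mathfrak{D}^{(2)}_t(y_1,y_2)$ are finite and $$\begin{aligned}\mathfrak{D}^{(2)}_t(y_1,y_2)&=\mathfrak{D}^{(1)}_t(y_1)\mathfrak{D}^{(1)}_t(y_2)+\kappa_t^2c_{t|1}^2\int_\Theta K_\phi(y_1,\theta)K_\phi(y_2,\theta)\,H(\mathrm{d}\theta)\\&\quad+2\kappa_t^2\rho_{t|1}c_{t|1}\int_\Theta K_\phi(y_1,\theta)K_\phi(y_2,\theta)\,\bar W_1(\mathrm{d}\theta)\\&\quad+\kappa_t^2\rho_{t|1}^2\,\mathrm{cov}\Big(\int_\Theta K_\phi(y_1,\theta)W_1(\mathrm{d}\theta),\int_\Theta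 K_\phi(y_2,\theta)W_1(\mathrm{d}\theta)\Big).\end{aligned}$$ -/

import Mathlib

open MeasureTheory ProbabilityTheory
open scoped NNReal ENNReal

noncomputable section

namespace SNMARG

/-- The class `BM₊(E)` of nonnegative, bounded, measurable functions with bounded support. -/
structure IsBMPlus {E : Type*} [MetricSpace E] [MeasurableSpace E] (f : E → ℝ≥0) : Prop where
  measurable : Measurable f
  bounded : ∃ C : ℝ≥0, ∀ x, f x ≤ C
  bounded_support : Bornology.IsBounded (Function.support f)

/-- Locally finite measures on a metric space: sets of bounded diameter have finite measure. -/
def FiniteOnBounded {E : Type*} [MetricSpace E] [MeasurableSpace E] (m : Measure E) : Prop :=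
  ∀ B : Set E, Bornology.IsBounded B → m B < ∞

/-- The Laplace functional of the noncentral gamma process of parameters `(H, M, c⁻¹)`:
`exp (- ∫ log (1 + c f) dH - ∫ c f / (1 + c f) dM)`. -/
def ncGammaLaplace {Θ : Type*} [MeasurableSpace Θ] (H M : Measure Θ) (c : ℝ≥0) (f : Θ → ℝ≥0) : ℝ :=
  Real.exp (-(∫ θ, Real.log (1 + (c : ℝ) * f θ) ∂H)
    - ∫ θ, ((c : ℝ) * f θ) / (1 + (c : ℝ) * f θ) ∂M)

/-- The σ-algebra generated by `W 1, …, W t` (measures carry the σ-algebra generated by the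
evaluations at measurable sets). -/
abbrev past {Ω Θ : Type*} [MeasurableSpace Θ] (W : ℕ → Ω → Measure Θ) (t : ℕ) : MeasurableSpace Ω :=
  ⨆ s ∈ Set.Icc 1 t, MeasurableSpace.comap (W s) inferInstance

/-- The σ-algebra generated by the whole process `(W t)`, `t ≥ 1`. -/
abbrev fullHistory {Ω Θ : Type*} [MeasurableSpace Θ] (W : ℕ → Ω → Measure Θ) : MeasurableSpace Ω :=
  ⨆ s ∈ Set.Ici 1, MeasurableSpace.comap (W s) inferInstance

/-- Measure-valued autoregressive gamma process of order one, indexed by `t ≥ 1` (the value at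
index `0` is irrelevant): a sequence of locally finite random measures such that the conditional
law of `W (t+1)` given `W 1, …, W t` is the noncentral gamma process of parameters
`(H, β (t+1) W t, c (t+1)⁻¹)`. The initial random measure `W 1` is arbitrary. -/
structure IsMARG1 {Ω Θ : Type*} [MeasurableSpace Ω] [MetricSpace Θ] [MeasurableSpace Θ]
    (P : Measure Ω) (H : Measure Θ) (β c : ℕ → ℝ≥0) (W : ℕ → Ω → Measure Θ) : Prop where
  base_finite : FiniteOnBounded H
  beta_pos : ∀ t, 2 ≤ t → 0 < β t
  c_pos : ∀ t, 2 ≤ t → 0 < c t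
  measurable : ∀ t, 1 ≤ t → Measurable (W t)
  finite : ∀ t, 1 ≤ t → ∀ ω, FiniteOnBounded (W t ω)
  transition : ∀ t, 1 ≤ t → ∀ f : Θ → ℝ≥0, IsBMPlus f →
    P[fun ω => Real.exp (-∫ θ, (f θ : ℝ) ∂(W (t + 1) ω)) | past W t]
      =ᵐ[P] fun ω => ncGammaLaplace H (β (t + 1) • W t ω) (c (t + 1)) f

/-- The shot-noise density `y ↦ ∫ K(y, θ) w(dθ)` associated with a measure `w`. -/
def shotNoise {Y Θ : Type*} [MeasurableSpace Θ] (K : Y → Θ → ℝ≥0) (w : Measure Θ) (y : Y) : ℝ≥0∞ :=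
  ∫⁻ θ, (K y θ : ℝ≥0∞) ∂w

/-- The measure `a · (∫ K(y, θ) w(dθ)) ℓ(dy)`. -/
def intensityMeasure {Y Θ : Type*} [MeasurableSpace Y] [MeasurableSpace Θ] (K : Y → Θ → ℝ≥0)
    (ℓ : Measure Y) (a : ℝ≥0) (w : Measure Θ) : Measure Y :=
  ℓ.withDensity fun y => (a : ℝ≥0∞) * shotNoise K w y

/-- Probability of the value `k : ℕ` under the Poisson law of mean `m ∈ [0, ∞]`, the law of
infinite mean being the point mass at `∞`. -/
def poissonWeight (m : ℝ≥0∞) (k : ℕ) : ℝ :=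
  if m = ∞ then 0 else (poissonMeasure m.toNNReal).real {k}

/-- Shot noise measure-valued autoregressive gamma process of order one: `W` is an M-ARG(1)
process, and given `W` the `N t`, `t ≥ 1`, are independent Poisson random measures with mean
measures `κ t · λ t(y) ℓ(dy)`, where `λ t(y) = ∫ K(y, θ) W t(dθ)`; that is, given `W`, the counts
`N (τ i) (B i)` are independent Poisson variables whenever the `B i` belonging to the same time
are pairwise disjoint. -/
structure IsSNMARG1 {Ω Y Θ : Type*} [MeasurableSpace Ω] [MetricSpace Y] [MeasurableSpace Y]
    [MetricSpace Θ] [MeasurableSpace Θ]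
    (P : Measure Ω) (H : Measure Θ) (β c κ : ℕ → ℝ≥0) (K : Y → Θ → ℝ≥0) (ℓ : Measure Y)
    (W : ℕ → Ω → Measure Θ) (N : ℕ → Ω → Measure Y) : Prop where
  marg : IsMARG1 P H β c W
  kernel_measurable : Measurable (Function.uncurry K)
  measurable : ∀ t, 1 ≤ t → Measurable (N t)
  poisson : ∀ (n : ℕ) (τ : Fin n → ℕ) (B : Fin n → Set Y) (k : Fin n → ℕ),
    (∀ i, 1 ≤ τ i) → (∀ i, MeasurableSet (B i)) → (∀ i, Bornology.IsBounded (B i)) →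
    (∀ i j, i ≠ j → τ i = τ j → Disjoint (B i) (B j)) →
    P⟦{ω | ∀ i, N (τ i) ω (B i) = (k i : ℝ≥0∞)} | fullHistory W⟧
      =ᵐ[P] fun ω => ∏ i, poissonWeight (intensityMeasure K ℓ (κ (τ i)) (W (τ i) ω) (B i)) (k i)

/-- The mean measure `A ↦ E(W(A))` of a random measure. -/
def meanMeasure {Ω Θ : Type*} [MeasurableSpace Ω] [MeasurableSpace Θ] (P : Measure Ω)
    (w : Ω → Measure Θ) : Measure Θ :=
  P.bind w

/-- `ρ_{s|t} = ∏_{j=t+1}^{s} β_j c_j`, equal to `1` for `s = t`. -/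
def rhoLag (β c : ℕ → ℝ≥0) (s t : ℕ) : ℝ≥0 :=
  ∏ j ∈ Finset.Ioc t s, β j * c j

/-- `c_{s|t} = c_s + ∑_{j=t+1}^{s-1} c_j ∏_{i=j+1}^{s} β_i c_i` for `s > t` (the first summand is
the term `j = s` of the sum below), and `c_{t|t} = 0`. -/
def cLag (β c : ℕ → ℝ≥0) (s t : ℕ) : ℝ≥0 :=
  ∑ j ∈ Finset.Ioc t s, c j * ∏ i ∈ Finset.Ioc j s, β i * c i

/-- `D` is an intensity of the point process `N` with respect to `ℓ`. -/
structure IsIntensity {Ω Y : Type*} [MeasurableSpace Ω] [MetricSpace Y] [MeasurableSpace Y]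
    (P : Measure Ω) (ℓ : Measure Y) (N : Ω → Measure Y) (D : Y → ℝ≥0∞) : Prop where
  measurable : Measurable D
  finite : ∀ B : Set Y, MeasurableSet B → Bornology.IsBounded B → ∫⁻ y in B, D y ∂ℓ < ∞
  moment : ∀ B : Set Y, MeasurableSet B → Bornology.IsBounded B →
    ∫⁻ ω, N ω B ∂P = ∫⁻ y in B, D y ∂ℓ

/-- `D₂` is a second-order product density of the point process `N`, whose intensity is `D₁`. -/
structure IsSecondOrderProductDensity {Ω Y : Type*} [MeasurableSpace Ω] [MetricSpace Y]
    [MeasurableSpace Y] (P : Measure Ω) (ℓ : Measure Y) (N : Ω → Measure Y)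
    (D₁ : Y → ℝ≥0∞) (D₂ : Y → Y → ℝ≥0∞) : Prop where
  measurable : Measurable (Function.uncurry D₂)
  finite : ∀ B₁ B₂ : Set Y, MeasurableSet B₁ → Bornology.IsBounded B₁ → MeasurableSet B₂ →
    Bornology.IsBounded B₂ → ∫⁻ p in B₁ ×ˢ B₂, D₂ p.1 p.2 ∂(ℓ.prod ℓ) < ∞
  moment : ∀ B₁ B₂ : Set Y, MeasurableSet B₁ → Bornology.IsBounded B₁ → MeasurableSet B₂ →
    Bornology.IsBounded B₂ →
    ∫⁻ ω, N ω B₁ * N ω B₂ ∂P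
      = ∫⁻ y in B₁ ∩ B₂, D₁ y ∂ℓ + ∫⁻ p in B₁ ×ˢ B₂, D₂ p.1 p.2 ∂(ℓ.prod ℓ)

/-- `D` is a cross second-order density of the point processes `N` and `N'`. -/
structure IsCrossSecondOrderDensity {Ω Y : Type*} [MeasurableSpace Ω] [MetricSpace Y]
    [MeasurableSpace Y] (P : Measure Ω) (ℓ : Measure Y) (N N' : Ω → Measure Y)
    (D : Y → Y → ℝ≥0∞) : Prop where
  measurable : Measurable (Function.uncurry D)
  finite : ∀ B₁ B₂ : Set Y, MeasurableSet B₁ → Bornology.IsBounded B₁ → MeasurableSet B₂ →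
    Bornology.IsBounded B₂ → ∫⁻ p in B₁ ×ˢ B₂, D p.1 p.2 ∂(ℓ.prod ℓ) < ∞
  moment : ∀ B₁ B₂ : Set Y, MeasurableSet B₁ → Bornology.IsBounded B₁ → MeasurableSet B₂ →
    Bornology.IsBounded B₂ →
    ∫⁻ ω, N ω B₁ * N' ω B₂ ∂P = ∫⁻ p in B₁ ×ˢ B₂, D p.1 p.2 ∂(ℓ.prod ℓ)

/-- The version `y ↦ κ_t E(λ_t(y))` of the intensity. -/
def density1 {Ω Y Θ : Type*} [MeasurableSpace Ω] [MeasurableSpace Θ] (P : Measure Ω)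
    (κ : ℕ → ℝ≥0) (K : Y → Θ → ℝ≥0) (W : ℕ → Ω → Measure Θ) (t : ℕ) (y : Y) : ℝ≥0∞ :=
  κ t * ∫⁻ ω, shotNoise K (W t ω) y ∂P

/-- The version `(y₁, y₂) ↦ κ_s κ_t E(λ_s(y₁) λ_t(y₂))` of the second-order product density
(for `s = t`) and of the cross second-order density (for `s ≠ t`). -/
def density2 {Ω Y Θ : Type*} [MeasurableSpace Ω] [MeasurableSpace Θ] (P : Measure Ω)
    (κ : ℕ → ℝ≥0) (K : Y → Θ → ℝ≥0) (W : ℕ → Ω → Measure Θ) (s t : ℕ) (y₁ y₂ : Y) : ℝ≥0∞ :=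
  κ s * κ t * ∫⁻ ω, shotNoise K (W s ω) y₁ * shotNoise K (W t ω) y₂ ∂P

/-- All integrals entering the closed form of the second-order product density converge at
`(y₁, y₂)`; here `w` is the initial random measure. -/
structure ConvergesAt {Ω Y Θ : Type*} [MeasurableSpace Ω] [MeasurableSpace Θ] (P : Measure Ω)
    (H : Measure Θ) (K : Y → Θ → ℝ≥0) (w : Ω → Measure Θ) (y₁ y₂ : Y) : Prop where
  left : shotNoise K (H + meanMeasure P w) y₁ < ∞
  right : shotNoise K (H + meanMeasure P w) y₂ < ∞
  both : ∫⁻ θ, (K y₁ θ : ℝ≥0∞) * K y₂ θ ∂(H + meanMeasure P w) < ∞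
  initial : ∫⁻ ω, shotNoise K (w ω) y₁ * shotNoise K (w ω) y₂ ∂P < ∞

end SNMARG

end

/-! Given W the counts are Poisson, so their first and second moments are those of the mean
measures, plus, at equal times, the mean of the overlap B₁ ∩ B₂. By Tonelli everything reduces to
first and second moments of ∫ f dW_t with f = K(y, ·).

These moments are read off the transition Laplace functional exp(-Ψ(f)), Ψ being `laplaceExponent`,
tested on s f as s → 0. To first order Ψ(s f) ~ s c (H f + M f) with M = β_{t+1} W_t, which gives
the conditional mean (`lintegral_bmPlus`). For products (`lintegral_mul_bmPlus`), the identity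
(1-e^{-x})(1-e^{-y}) + e^{-z}(1-e^{-(x+y-z)}) = 1 - e^{-x} - e^{-y} + e^{-z} at x = Ψ(s f), y = Ψ(s
g), z = Ψ(s(f+g)) separates the product of the conditional means from the conditional covariance.
The latter is the limit of s⁻²(x+y-z), namely c² H(fg) + 2c² M(fg). Every approximating expression
is nonnegative and at most its limit, so Fatou's lemma and this bound give convergence in [0, ∞]
without any integrability (`tendsto_lintegral_of_le`).

Conditioning on the past amounts to restricting P to past events, which gives the regression of
W_{t+1} on the past (`lintegral_mul_succ`). Induction on time solves the resulting affine
recursions: `lintegral_mul_lag` for the regression at any lag, `lintegral_mul_self` for the second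
moments. The closed forms are then algebra in [0, ∞]. The moment hypotheses make the integrals over
bounded sets finite; finite means also make the counts almost surely finite, as the Poisson
summations require. -/

namespace SNMARG

open Filter Topology

/-! ### Elementary inequalities and limits for `exp`, `log (1 + u)` and `u / (1 + u)`. -/

section RealLimits

lemma div_one_add_le_log {s u : ℝ} (hs : 0 < s) (hu : 0 ≤ u) :
    u / (1 + s * u) ≤ s⁻¹ * Real.log (1 + s * u) := by
  have h1 : 0 < 1 + s * u := by positivity
  have h := Real.one_sub_inv_le_log_of_pos h1
  have h2 : u / (1 + s * u) = s⁻¹ * (1 - (1 + s * u)⁻¹) := by field_simp; ring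
  rw [h2]
  gcongr

lemma inv_mul_log_le {s u : ℝ} (hs : 0 < s) (hu : 0 ≤ u) :
    s⁻¹ * Real.log (1 + s * u) ≤ u := by
  have h1 : 0 < 1 + s * u := by positivity
  have h := Real.log_le_sub_one_of_pos h1
  calc s⁻¹ * Real.log (1 + s * u) ≤ s⁻¹ * (1 + s * u - 1) := by gcongr
    _ = u := by field_simp; ring

lemma div_one_add_le_one_sub_exp {x : ℝ} (hx : 0 ≤ x) : x / (1 + x) ≤ 1 - Real.exp (-x) := by
  have h := Real.add_one_le_exp x
  have h1 : Real.exp (-x) ≤ (1 + x)⁻¹ := by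
    rw [Real.exp_neg]
    gcongr
    linarith
  have h2 : x / (1 + x) = 1 - (1 + x)⁻¹ := by field_simp; ring
  linarith

lemma one_sub_exp_le (x : ℝ) : 1 - Real.exp (-x) ≤ x := by
  have := Real.add_one_le_exp (-x)
  linarith

/-- Squeeze between x / (1 + x) and x. The rate `r` is s⁻¹ for first moments and s⁻² for the
covariance term. -/
lemma tendsto_mul_one_sub_exp {r x : ℕ → ℝ} {a : ℝ} (hx : ∀ n, 0 ≤ x n) (hr : ∀ n, 0 ≤ r n)
    (hx0 : Tendsto x atTop (𝓝 0)) (h : Tendsto (fun n => r n * x n) atTop (𝓝 a)) :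
    Tendsto (fun n => r n * (1 - Real.exp (-x n))) atTop (𝓝 a) := by
  have h1 : Tendsto (fun n => r n * x n / (1 + x n)) atTop (𝓝 a) := by
    have := h.div (tendsto_const_nhds (x := (1 : ℝ)).add hx0) (by norm_num)
    simpa [Pi.div_def] using this
  refine tendsto_of_tendsto_of_tendsto_of_le_of_le h1 h (fun n => ?_) (fun n => ?_)
  · simp only [mul_div_assoc]
    exact mul_le_mul_of_nonneg_left (div_one_add_le_one_sub_exp (hx n)) (hr n)
  · exact mul_le_mul_of_nonneg_left (one_sub_exp_le _) (hr n)

lemma tendsto_div_one_add {s : ℕ → ℝ} (hs0 : Tendsto s atTop (𝓝 0)) (u v : ℝ) :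
    Tendsto (fun n => v / (1 + s n * u)) atTop (𝓝 v) := by
  have := (tendsto_const_nhds (x := v)).div
    (tendsto_const_nhds (x := (1 : ℝ)).add (hs0.mul_const u)) (by norm_num)
  simpa [Pi.div_def] using this

lemma tendsto_inv_mul_log {s : ℕ → ℝ} (hs : ∀ n, 0 < s n) (hs0 : Tendsto s atTop (𝓝 0)) {u : ℝ}
    (hu : 0 ≤ u) : Tendsto (fun n => (s n)⁻¹ * Real.log (1 + s n * u)) atTop (𝓝 u) :=
  tendsto_of_tendsto_of_tendsto_of_le_of_le (tendsto_div_one_add hs0 u u) tendsto_const_nhds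
    (fun n => div_one_add_le_log (hs n) hu) (fun n => inv_mul_log_le (hs n) hu)

/-- The defect of additivity of `u ↦ log (1 + u)`. -/
lemma log_add_log_sub_log {a b : ℝ} (ha : 0 ≤ a) (hb : 0 ≤ b) :
    Real.log (1 + a) + Real.log (1 + b) - Real.log (1 + (a + b))
      = Real.log (1 + a * b / (1 + (a + b))) := by
  rw [← Real.log_mul (by positivity) (by positivity), ← Real.log_div (by positivity) (by positivity)]
  congr 1
  field_simp
  ring

/-- The defect of additivity of `u ↦ u / (1 + u)`. -/
lemma ratio_add_ratio_sub_ratio {a b : ℝ} (ha : 0 ≤ a) (hb : 0 ≤ b) :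
    a / (1 + a) + b / (1 + b) - (a + b) / (1 + (a + b))
      = a * b * ((1 + a)⁻¹ * (1 + b)⁻¹ * (1 + (1 + (a + b))⁻¹)) := by
  field_simp
  ring

lemma log_defect_nonneg {a b : ℝ} (ha : 0 ≤ a) (hb : 0 ≤ b) :
    0 ≤ Real.log (1 + a) + Real.log (1 + b) - Real.log (1 + (a + b)) := by
  rw [log_add_log_sub_log ha hb]
  exact Real.log_nonneg (by have : 0 ≤ a * b / (1 + (a + b)) := by positivity
                            linarith)

lemma log_defect_le {a b : ℝ} (ha : 0 ≤ a) (hb : 0 ≤ b) :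
    Real.log (1 + a) + Real.log (1 + b) - Real.log (1 + (a + b)) ≤ a * b := by
  rw [log_add_log_sub_log ha hb]
  have h := Real.log_le_sub_one_of_pos (x := 1 + a * b / (1 + (a + b))) (by positivity)
  have h2 : a * b / (1 + (a + b)) ≤ a * b := div_le_self (by positivity) (by linarith)
  linarith

/-- The bound x / (1 + x) ≤ log (1 + x) at x = ab / (1 + a + b). It is the lower half of the squeeze
whose upper half is `log_defect_le`. -/
lemma le_log_defect {a b : ℝ} (ha : 0 ≤ a) (hb : 0 ≤ b) :
    a * b / (1 + (a + b) + a * b)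
      ≤ Real.log (1 + a) + Real.log (1 + b) - Real.log (1 + (a + b)) := by
  rw [log_add_log_sub_log ha hb]
  have h := div_one_add_le_log (s := 1) (u := a * b / (1 + (a + b))) one_pos (by positivity)
  simp only [one_mul, inv_one] at h
  refine le_trans (le_of_eq ?_) h
  field_simp

lemma ratio_defect_nonneg {a b : ℝ} (ha : 0 ≤ a) (hb : 0 ≤ b) :
    0 ≤ a / (1 + a) + b / (1 + b) - (a + b) / (1 + (a + b)) := by
  rw [ratio_add_ratio_sub_ratio ha hb]
  positivity

lemma ratio_defect_le {a b : ℝ} (ha : 0 ≤ a) (hb : 0 ≤ b) :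
    a / (1 + a) + b / (1 + b) - (a + b) / (1 + (a + b)) ≤ 2 * (a * b) := by
  rw [ratio_add_ratio_sub_ratio ha hb]
  have h1 : (1 + a)⁻¹ ≤ 1 := inv_le_one_of_one_le₀ (by linarith)
  have h2 : (1 + b)⁻¹ ≤ 1 := inv_le_one_of_one_le₀ (by linarith)
  have h3 : (1 + (a + b))⁻¹ ≤ 1 := inv_le_one_of_one_le₀ (by linarith)
  have h4 : (1 + a)⁻¹ * (1 + b)⁻¹ * (1 + (1 + (a + b))⁻¹) ≤ 1 * 1 * (1 + 1) := by gcongr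
  nlinarith [mul_nonneg ha hb]

lemma tendsto_log_defect {s : ℕ → ℝ} (hs : ∀ n, 0 < s n) (hs0 : Tendsto s atTop (𝓝 0)) {u v : ℝ}
    (hu : 0 ≤ u) (hv : 0 ≤ v) :
    Tendsto (fun n => (s n)⁻¹ ^ 2 * (Real.log (1 + s n * u) + Real.log (1 + s n * v)
      - Real.log (1 + (s n * u + s n * v)))) atTop (𝓝 (u * v)) := by
  have h1 : Tendsto (fun n => u * v / (1 + (s n * u + s n * v) + s n * u * (s n * v))) atTop
      (𝓝 (u * v)) := by
    have hd : Tendsto (fun n => 1 + (s n * u + s n * v) + s n * u * (s n * v)) atTop (𝓝 1) := by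
      have := ((hs0.mul_const u).add (hs0.mul_const v)).const_add 1 |>.add
        ((hs0.mul_const u).mul (hs0.mul_const v))
      simpa using this
    simpa [Pi.div_def] using (tendsto_const_nhds (x := u * v)).div hd one_ne_zero
  refine tendsto_of_tendsto_of_tendsto_of_le_of_le h1 tendsto_const_nhds (fun n => ?_) fun n => ?_
  · have hsn := hs n
    have h := le_log_defect (a := s n * u) (b := s n * v) (by positivity) (by positivity)
    refine le_trans (le_of_eq ?_) (mul_le_mul_of_nonneg_left h (by positivity))
    field_simp
  · have hsn := hs n
    have h := log_defect_le (a := s n * u) (b := s n * v) (by positivity) (by positivity)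
    refine le_trans (mul_le_mul_of_nonneg_left h (by positivity)) (le_of_eq ?_)
    field_simp

/-- The factor 2, which reappears in front of the W̄₁ term of the final formula, is the limit of 1 +
(1 + s(u + v))⁻¹. -/
lemma tendsto_ratio_defect {s : ℕ → ℝ} (hs : ∀ n, 0 < s n) (hs0 : Tendsto s atTop (𝓝 0)) {u v : ℝ}
    (hu : 0 ≤ u) (hv : 0 ≤ v) :
    Tendsto (fun n => (s n)⁻¹ ^ 2 * (s n * u / (1 + s n * u) + s n * v / (1 + s n * v)
      - (s n * u + s n * v) / (1 + (s n * u + s n * v)))) atTop (𝓝 (2 * (u * v))) := by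
  have h1 : ∀ w : ℝ, Tendsto (fun n => (1 + s n * w)⁻¹) atTop (𝓝 1) := fun w => by
    simpa using tendsto_div_one_add hs0 w 1
  have h := (((h1 u).mul (h1 v)).mul ((h1 (u + v)).const_add 1)).const_mul (u * v)
  have e : u * v * (1 * 1 * (1 + 1)) = 2 * (u * v) := by ring
  rw [e] at h
  refine h.congr fun n => ?_
  have hsn := hs n
  rw [ratio_add_ratio_sub_ratio (by positivity) (by positivity), ← mul_add]
  field_simp

end RealLimits

/-! ### Passage to the limit under a bound by the limit itself. -/

section Integrals

variable {Θ : Type*} [MeasurableSpace Θ]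

/-- Dominated convergence with the limit as its own majorant. The bounds on the integrals are kept
because the next limit, over the probability space, needs domination by the limit again. -/
lemma tendsto_integral_of_nonneg_le {w : Measure Θ} {q : ℕ → Θ → ℝ} {Q : Θ → ℝ}
    (hq : ∀ n, Measurable (q n)) (hQ : Integrable Q w) (h0 : ∀ n θ, 0 ≤ q n θ)
    (hle : ∀ n θ, q n θ ≤ Q θ) (hlim : ∀ θ, Tendsto (fun n => q n θ) atTop (𝓝 (Q θ))) :
    Tendsto (fun n => ∫ θ, q n θ ∂w) atTop (𝓝 (∫ θ, Q θ ∂w)) ∧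
      (∀ n, 0 ≤ ∫ θ, q n θ ∂w) ∧ ∀ n, ∫ θ, q n θ ∂w ≤ ∫ θ, Q θ ∂w := by
  refine ⟨?_, fun n => integral_nonneg (h0 n), fun n => integral_mono_of_nonneg
    (Eventually.of_forall (h0 n)) hQ (Eventually.of_forall (hle n))⟩
  refine tendsto_integral_of_dominated_convergence Q (fun n => (hq n).aestronglyMeasurable) hQ
    (fun n => Eventually.of_forall fun θ => ?_) (Eventually.of_forall hlim)
  rw [Real.norm_eq_abs, abs_of_nonneg (h0 n θ)]
  exact hle n θ

/-- Fatou bounds the liminf from below, and the pointwise bound controls the limsup. Neither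
monotonicity nor a finite integral is needed, so the limit may be ∞. -/
lemma tendsto_lintegral_of_le {Ω : Type*} [MeasurableSpace Ω] {μ : Measure Ω} {a : ℕ → Ω → ℝ≥0∞}
    {b : Ω → ℝ≥0∞} (ha : ∀ n, Measurable (a n)) (hle : ∀ n ω, a n ω ≤ b ω)
    (hlim : ∀ ω, Tendsto (fun n => a n ω) atTop (𝓝 (b ω))) :
    Tendsto (fun n => ∫⁻ ω, a n ω ∂μ) atTop (𝓝 (∫⁻ ω, b ω ∂μ)) := by
  refine tendsto_of_le_liminf_of_limsup_le ?_ ?_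
  · calc ∫⁻ ω, b ω ∂μ = ∫⁻ ω, liminf (fun n => a n ω) atTop ∂μ := by
          congr with ω
          exact (hlim ω).liminf_eq.symm
      _ ≤ _ := lintegral_liminf_le ha
  · exact limsup_le_of_le (by isBoundedDefault)
      (Eventually.of_forall fun n => lintegral_mono (hle n))

end Integrals

/-! ### The Laplace exponent and its defect of additivity. -/

section Exponent

variable {Θ : Type*} [MeasurableSpace Θ]

/-- The exponent of the Laplace functional of the noncentral gamma process. -/
noncomputable def laplaceExponent (H M : Measure Θ) (c : ℝ≥0) (f : Θ → ℝ≥0) : ℝ :=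
  ∫ θ, Real.log (1 + (c : ℝ) * f θ) ∂H + ∫ θ, ((c : ℝ) * f θ) / (1 + (c : ℝ) * f θ) ∂M

lemma ncGammaLaplace_eq (H M : Measure Θ) (c : ℝ≥0) (f : Θ → ℝ≥0) :
    ncGammaLaplace H M c f = Real.exp (-laplaceExponent H M c f) := by
  rw [ncGammaLaplace, laplaceExponent, neg_add, sub_eq_add_neg]

/-- The defect of additivity of the Laplace exponent. -/
noncomputable def laplaceDefect (H M : Measure Θ) (c : ℝ≥0) (f g : Θ → ℝ≥0) : ℝ :=
  laplaceExponent H M c f + laplaceExponent H M c g - laplaceExponent H M c (fun θ => f θ + g θ)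

end Exponent

/-! ### Small-scale expansion of the Laplace exponent on test functions. -/

section Laplace

variable {Θ : Type*} [MetricSpace Θ] [MeasurableSpace Θ]

/-- A test function is bounded on a set of finite measure, hence integrable. This keeps the Bochner
integrals in the Laplace functional away from their default value 0. -/
lemma IsBMPlus.integrable_of_le [OpensMeasurableSpace Θ] {f : Θ → ℝ≥0} (hf : IsBMPlus f)
    {w : Measure Θ} (hw : FiniteOnBounded w) {q : Θ → ℝ} (hq : Measurable q) (C : ℝ)
    (h0 : ∀ θ, 0 ≤ q θ) (hle : ∀ θ, q θ ≤ C * f θ) : Integrable q w := by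
  obtain ⟨D, hD⟩ := hf.bounded
  have hS : MeasurableSet (Function.support f) := measurableSet_support hf.measurable
  have hf' : Integrable (fun θ => (f θ : ℝ)) w := by
    rw [← integrableOn_iff_integrable_of_support_subset (s := Function.support f)
      (fun θ hθ => by simpa using hθ)]
    refine IntegrableOn.of_bound (hw _ hf.bounded_support)
      (by have := hf.measurable; fun_prop) (D : ℝ) (Eventually.of_forall fun θ => ?_)
    simpa using hD θ
  refine (hf'.const_mul C).mono' hq.aestronglyMeasurable (Eventually.of_forall fun θ => ?_)
  rw [Real.norm_eq_abs, abs_of_nonneg (h0 θ)]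
  exact hle θ

lemma IsBMPlus.integrable [OpensMeasurableSpace Θ] {f : Θ → ℝ≥0} (hf : IsBMPlus f)
    {w : Measure Θ} (hw : FiniteOnBounded w) : Integrable (fun θ => (f θ : ℝ)) w :=
  hf.integrable_of_le hw (by have := hf.measurable; fun_prop) 1 (fun θ => by positivity)
    (fun θ => by simp)

lemma IsBMPlus.const_mul {f : Θ → ℝ≥0} (hf : IsBMPlus f) (a : ℝ≥0) :
    IsBMPlus fun θ => a * f θ where
  measurable := hf.measurable.const_mul a
  bounded := by
    obtain ⟨C, hC⟩ := hf.bounded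
    exact ⟨a * C, fun x => by gcongr; exact hC x⟩
  bounded_support := hf.bounded_support.subset fun θ hθ => by
    simp only [Function.mem_support, ne_eq, mul_eq_zero, not_or] at hθ
    exact hθ.2

lemma IsBMPlus.add {f g : Θ → ℝ≥0} (hf : IsBMPlus f) (hg : IsBMPlus g) :
    IsBMPlus fun θ => f θ + g θ where
  measurable := hf.measurable.add hg.measurable
  bounded := by
    obtain ⟨C, hC⟩ := hf.bounded
    obtain ⟨D, hD⟩ := hg.bounded
    exact ⟨C + D, fun x => add_le_add (hC x) (hD x)⟩
  bounded_support := (hf.bounded_support.union hg.bounded_support).subset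
    (Function.support_add f g)

variable [OpensMeasurableSpace Θ] {H M : Measure Θ} {f g : Θ → ℝ≥0}

/-- Both log (1 + su) / s and u / (1 + su) are at most u and tend to u, so the two integrals
contribute equally at first order. -/
lemma laplaceExponent_scaled (hH : FiniteOnBounded H) (hM : FiniteOnBounded M) (c : ℝ≥0)
    (hf : IsBMPlus f) {s : ℕ → ℝ≥0} (hs : ∀ n, 0 < s n)
    (hs0 : Tendsto (fun n => (s n : ℝ)) atTop (𝓝 0)) :
    Tendsto (fun n => (s n : ℝ)⁻¹ * laplaceExponent H M c (fun θ => s n * f θ)) atTop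
        (𝓝 (c * (∫ θ, (f θ : ℝ) ∂H + ∫ θ, (f θ : ℝ) ∂M))) ∧
      (∀ n, 0 ≤ laplaceExponent H M c (fun θ => s n * f θ)) ∧
      ∀ n, (s n : ℝ)⁻¹ * laplaceExponent H M c (fun θ => s n * f θ)
        ≤ c * (∫ θ, (f θ : ℝ) ∂H + ∫ θ, (f θ : ℝ) ∂M) := by
  have hs' : ∀ n, 0 < (s n : ℝ) := fun n => by exact_mod_cast hs n
  have hmf := hf.measurable
  have key : ∀ n, (s n : ℝ)⁻¹ * laplaceExponent H M c (fun θ => s n * f θ)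
      = ∫ θ, (s n : ℝ)⁻¹ * Real.log (1 + s n * (c * f θ)) ∂H
        + ∫ θ, ((c : ℝ) * f θ) / (1 + s n * (c * f θ)) ∂M := fun n => by
    have := hs' n
    rw [laplaceExponent, mul_add, ← integral_const_mul, ← integral_const_mul]
    congr 1
    · refine integral_congr_ae (Eventually.of_forall fun θ => ?_)
      push_cast
      ring_nf
    · refine integral_congr_ae (Eventually.of_forall fun θ => ?_)
      push_cast
      have h0 : 0 ≤ (s n : ℝ) * (c * f θ) := by positivity
      rw [show (c : ℝ) * (s n * f θ) = s n * (c * f θ) by ring]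
      field_simp
  have h1 := tendsto_integral_of_nonneg_le (w := H)
    (q := fun n θ => (s n : ℝ)⁻¹ * Real.log (1 + s n * (c * f θ))) (Q := fun θ => (c : ℝ) * f θ)
    (fun n => by fun_prop) ((hf.integrable hH).const_mul _)
    (fun n θ => mul_nonneg (by positivity) (Real.log_nonneg (by
      have : 0 ≤ (s n : ℝ) * (c * f θ) := by positivity
      linarith)))
    (fun n θ => inv_mul_log_le (hs' n) (by positivity))
    (fun θ => tendsto_inv_mul_log hs' hs0 (by positivity))
  have h2 := tendsto_integral_of_nonneg_le (w := M)
    (q := fun n θ => ((c : ℝ) * f θ) / (1 + s n * (c * f θ))) (Q := fun θ => (c : ℝ) * f θ)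
    (fun n => by fun_prop) ((hf.integrable hM).const_mul _)
    (fun n θ => by positivity)
    (fun n θ => div_le_self (by positivity) (by
      have : 0 ≤ (s n : ℝ) * (c * f θ) := by positivity
      linarith))
    (fun θ => tendsto_div_one_add hs0 _ _)
  simp only [key]
  rw [mul_add, ← integral_const_mul, ← integral_const_mul]
  refine ⟨h1.1.add h2.1, fun n => ?_, fun n => add_le_add (h1.2.2 n) (h2.2.2 n)⟩
  have h3 := add_nonneg (h1.2.1 n) (h2.2.1 n)
  rw [← key] at h3
  exact nonneg_of_mul_nonneg_right h3 (inv_pos.2 (hs' n))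

lemma IsBMPlus.integrable_log (hf : IsBMPlus f) (hH : FiniteOnBounded H) (c : ℝ≥0) :
    Integrable (fun θ => Real.log (1 + (c : ℝ) * f θ)) H := by
  have hmf := hf.measurable
  refine hf.integrable_of_le hH (by fun_prop) c (fun θ => Real.log_nonneg ?_) fun θ => ?_
  · have : 0 ≤ (c : ℝ) * f θ := by positivity
    linarith
  · have := inv_mul_log_le (s := 1) (u := c * f θ) one_pos (by positivity)
    simpa using this

lemma IsBMPlus.integrable_ratio (hf : IsBMPlus f) (hM : FiniteOnBounded M) (c : ℝ≥0) :
    Integrable (fun θ => (c : ℝ) * f θ / (1 + (c : ℝ) * f θ)) M := by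
  have hmf := hf.measurable
  refine hf.integrable_of_le hM (by fun_prop) c (fun θ => by positivity) fun θ => ?_
  refine div_le_self (by positivity) ?_
  have : 0 ≤ (c : ℝ) * f θ := by positivity
  linarith

lemma laplaceDefect_eq (hH : FiniteOnBounded H) (hM : FiniteOnBounded M) (c : ℝ≥0)
    (hf : IsBMPlus f) (hg : IsBMPlus g) :
    laplaceDefect H M c f g
      = ∫ θ, (Real.log (1 + (c : ℝ) * f θ) + Real.log (1 + (c : ℝ) * g θ)
          - Real.log (1 + ((c : ℝ) * f θ + c * g θ))) ∂H
        + ∫ θ, ((c : ℝ) * f θ / (1 + (c : ℝ) * f θ) + (c : ℝ) * g θ / (1 + (c : ℝ) * g θ)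
          - ((c : ℝ) * f θ + c * g θ) / (1 + ((c : ℝ) * f θ + c * g θ))) ∂M := by
  have i1 := (hf.add hg).integrable_log hH c
  have i2 := (hf.add hg).integrable_ratio hM c
  push_cast [mul_add] at i1 i2
  rw [integral_sub ((hf.integrable_log hH c).fun_add (hg.integrable_log hH c)) i1,
    integral_sub ((hf.integrable_ratio hM c).fun_add (hg.integrable_ratio hM c)) i2,
    integral_add (hf.integrable_log hH c) (hg.integrable_log hH c),
    integral_add (hf.integrable_ratio hM c) (hg.integrable_ratio hM c)]
  simp only [laplaceDefect, laplaceExponent]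
  push_cast [mul_add]
  ring

/-- Pointwise, the defect of the logarithm is at most ab and equivalent to it, and that of the ratio
is at most 2ab and equivalent to it, with a = s c f and b = s c g. Hence c² in front of H and 2c² in
front of M. -/
lemma laplaceDefect_scaled (hH : FiniteOnBounded H) (hM : FiniteOnBounded M) (c : ℝ≥0)
    (hf : IsBMPlus f) (hg : IsBMPlus g) {s : ℕ → ℝ≥0} (hs : ∀ n, 0 < s n)
    (hs0 : Tendsto (fun n => (s n : ℝ)) atTop (𝓝 0)) :
    Tendsto (fun n => (s n : ℝ)⁻¹ ^ 2 *
        laplaceDefect H M c (fun θ => s n * f θ) (fun θ => s n * g θ)) atTop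
        (𝓝 (c ^ 2 * ∫ θ, (f θ : ℝ) * g θ ∂H + 2 * c ^ 2 * ∫ θ, (f θ : ℝ) * g θ ∂M)) ∧
      (∀ n, 0 ≤ laplaceDefect H M c (fun θ => s n * f θ) (fun θ => s n * g θ)) ∧
      ∀ n, (s n : ℝ)⁻¹ ^ 2 * laplaceDefect H M c (fun θ => s n * f θ) (fun θ => s n * g θ)
        ≤ c ^ 2 * ∫ θ, (f θ : ℝ) * g θ ∂H + 2 * c ^ 2 * ∫ θ, (f θ : ℝ) * g θ ∂M := by
  have hs' : ∀ n, 0 < (s n : ℝ) := fun n => by exact_mod_cast hs n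
  have hmf := hf.measurable
  have hmg := hg.measurable
  have hfg : ∀ w : Measure Θ, FiniteOnBounded w → Integrable (fun θ => (f θ : ℝ) * g θ) w := by
    intro w hw
    obtain ⟨D, hD⟩ := hg.bounded
    refine hf.integrable_of_le hw (by fun_prop) D (fun θ => by positivity) fun θ => ?_
    rw [mul_comm]
    gcongr
    exact_mod_cast hD θ
  have e1 : ∀ n (x : ℝ≥0), (c : ℝ) * ((s n * x : ℝ≥0) : ℝ) = s n * (c * x) := fun n x => by
    push_cast
    ring
  have key : ∀ n, (s n : ℝ)⁻¹ ^ 2 *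
      laplaceDefect H M c (fun θ => s n * f θ) (fun θ => s n * g θ)
      = ∫ θ, (s n : ℝ)⁻¹ ^ 2 * (Real.log (1 + s n * (c * f θ)) + Real.log (1 + s n * (c * g θ))
          - Real.log (1 + (s n * (c * f θ) + s n * (c * g θ)))) ∂H
        + ∫ θ, (s n : ℝ)⁻¹ ^ 2 * (s n * (c * f θ) / (1 + s n * (c * f θ))
          + s n * (c * g θ) / (1 + s n * (c * g θ))
          - (s n * (c * f θ) + s n * (c * g θ)) / (1 + (s n * (c * f θ) + s n * (c * g θ)))) ∂M :=
    fun n => by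
      rw [laplaceDefect_eq hH hM c (hf.const_mul _) (hg.const_mul _), mul_add,
        ← integral_const_mul, ← integral_const_mul]
      simp only [e1]
  have e2 : ∀ (n : ℕ) (x y : ℝ), (s n : ℝ)⁻¹ ^ 2 * (s n * x * (s n * y)) = x * y := fun n x y => by
    have := hs' n
    field_simp
  have h1 := tendsto_integral_of_nonneg_le (w := H)
    (q := fun n θ => (s n : ℝ)⁻¹ ^ 2 * (Real.log (1 + s n * (c * f θ))
      + Real.log (1 + s n * (c * g θ)) - Real.log (1 + (s n * (c * f θ) + s n * (c * g θ)))))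
    (Q := fun θ => (c : ℝ) * f θ * (c * g θ))
    (fun n => by fun_prop) (((hfg H hH).const_mul (c ^ 2 : ℝ)).congr
      (Eventually.of_forall fun θ => by simp only; ring))
    (fun n θ => mul_nonneg (by positivity) (log_defect_nonneg (by positivity) (by positivity)))
    (fun n θ => by
      refine le_trans (mul_le_mul_of_nonneg_left
        (log_defect_le (by positivity) (by positivity)) (by positivity)) (e2 n _ _).le)
    (fun θ => tendsto_log_defect hs' hs0 (by positivity) (by positivity))
  have h2 := tendsto_integral_of_nonneg_le (w := M)
    (q := fun n θ => (s n : ℝ)⁻¹ ^ 2 * (s n * (c * f θ) / (1 + s n * (c * f θ))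
          + s n * (c * g θ) / (1 + s n * (c * g θ))
          - (s n * (c * f θ) + s n * (c * g θ)) / (1 + (s n * (c * f θ) + s n * (c * g θ)))))
    (Q := fun θ => 2 * ((c : ℝ) * f θ * (c * g θ)))
    (fun n => by fun_prop) (((hfg M hM).const_mul (2 * c ^ 2 : ℝ)).congr
      (Eventually.of_forall fun θ => by simp only; ring))
    (fun n θ => mul_nonneg (by positivity) (ratio_defect_nonneg (by positivity) (by positivity)))
    (fun n θ => by
      refine le_trans (mul_le_mul_of_nonneg_left
        (ratio_defect_le (by positivity) (by positivity)) (by positivity)) (le_of_eq ?_)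
      rw [mul_left_comm, e2])
    (fun θ => tendsto_ratio_defect hs' hs0 (by positivity) (by positivity))
  have e3 : c ^ 2 * ∫ θ, (f θ : ℝ) * g θ ∂H + 2 * c ^ 2 * ∫ θ, (f θ : ℝ) * g θ ∂M
      = ∫ θ, (c : ℝ) * f θ * (c * g θ) ∂H + ∫ θ, 2 * ((c : ℝ) * f θ * (c * g θ)) ∂M := by
    rw [← integral_const_mul, ← integral_const_mul]
    congr 1
    · congr with θ
      ring
    · congr with θ
      ring
  simp only [key]
  rw [e3]
  refine ⟨h1.1.add h2.1, fun n => ?_, fun n => add_le_add (h1.2.2 n) (h2.2.2 n)⟩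
  have h3 := add_nonneg (h1.2.1 n) (h2.2.1 n)
  rw [← key] at h3
  exact nonneg_of_mul_nonneg_right h3 (by have := hs' n; positivity)

end Laplace

/-! ### First and second moments of noncentral gamma mixtures, on test functions. -/

section Moments

variable {Ω Θ : Type*} [MeasurableSpace Ω] [MeasurableSpace Θ]

lemma measurable_integral_of_nonneg {q : Θ → ℝ} (hq : Measurable q) (h0 : ∀ θ, 0 ≤ q θ) :
    Measurable fun w : Measure Θ => ∫ θ, q θ ∂w := by
  have h : (fun w : Measure Θ => ∫ θ, q θ ∂w)
      = fun w => (∫⁻ θ, ENNReal.ofReal (q θ) ∂w).toReal := by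
    funext w
    exact integral_eq_lintegral_of_nonneg_ae (Eventually.of_forall h0) hq.aestronglyMeasurable
  rw [h]
  exact (Measure.measurable_lintegral hq.ennreal_ofReal).ennreal_toReal

lemma measurable_laplaceExponent (H : Measure Θ) (c : ℝ≥0) {f : Θ → ℝ≥0} (hf : Measurable f) :
    Measurable fun M => laplaceExponent H M c f :=
  (measurable_integral_of_nonneg (by fun_prop) fun θ => by positivity).const_add _

lemma laplaceExponent_nonneg (H w : Measure Θ) (c : ℝ≥0) (f : Θ → ℝ≥0) :
    0 ≤ laplaceExponent H w c f := by
  refine add_nonneg (integral_nonneg fun θ => Real.log_nonneg ?_) (integral_nonneg fun θ => ?_)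
  · have : 0 ≤ (c : ℝ) * f θ := by positivity
    linarith
  · positivity

lemma exists_scale : ∃ s : ℕ → ℝ≥0, (∀ n, 0 < s n) ∧
    Tendsto (fun n => (s n : ℝ)) atTop (𝓝 0) := by
  refine ⟨fun n => ((n : ℝ≥0) + 1)⁻¹, fun n => by positivity, ?_⟩
  simpa using tendsto_one_div_add_atTop_nhds_zero_nat (𝕜 := ℝ)

lemma integrable_exp_neg {μ : Measure Ω} [IsFiniteMeasure μ] {X : Ω → ℝ} (hX : Measurable X) (h0 : ∀ ω, 0 ≤ X ω) :
    Integrable (fun ω => Real.exp (-X ω)) μ := by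
  refine Integrable.of_bound (by fun_prop) 1 (Eventually.of_forall fun ω => ?_)
  rw [Real.norm_eq_abs, abs_of_pos (Real.exp_pos _), Real.exp_le_one_iff]
  linarith [h0 ω]

/-- Multiplication on [0, ∞] is discontinuous at (0, ∞). The bounds rescue that case: a sequence
dominated by a zero limit vanishes identically. -/
lemma tendsto_mul_of_le {a b : ℕ → ℝ≥0∞} {x y : ℝ≥0∞} (ha : Tendsto a atTop (𝓝 x))
    (hb : Tendsto b atTop (𝓝 y)) (hax : ∀ n, a n ≤ x) (hby : ∀ n, b n ≤ y) :
    Tendsto (fun n => a n * b n) atTop (𝓝 (x * y)) := by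
  rcases eq_or_ne x 0 with rfl | hx
  · simp [fun n => le_antisymm (hax n) (zero_le)]
  rcases eq_or_ne y 0 with rfl | hy
  · simp [fun n => le_antisymm (hby n) (zero_le)]
  exact ENNReal.Tendsto.mul ha (Or.inl hx) hb (Or.inl hy)

variable [MetricSpace Θ]

/-- Under `μ`, the Laplace functional of `V` is a mixture over `M` of Laplace functionals of
noncentral gamma processes of parameters `(H, M, c⁻¹)`. -/
structure IsNCGammaMixture (μ : Measure Ω) (H : Measure Θ) (c : ℝ≥0) (V M : Ω → Measure Θ) :
    Prop where
  base_finite : FiniteOnBounded H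
  measurable_left : Measurable V
  measurable_right : Measurable M
  finite_left : ∀ ω, FiniteOnBounded (V ω)
  finite_right : ∀ ω, FiniteOnBounded (M ω)
  laplace : ∀ f : Θ → ℝ≥0, IsBMPlus f →
    ∫ ω, Real.exp (-∫ θ, (f θ : ℝ) ∂V ω) ∂μ = ∫ ω, ncGammaLaplace H (M ω) c f ∂μ

lemma IsBMPlus.mul {f g : Θ → ℝ≥0} (hf : IsBMPlus f) (hg : IsBMPlus g) :
    IsBMPlus fun θ => f θ * g θ where
  measurable := hf.measurable.mul hg.measurable
  bounded := by
    obtain ⟨C, hC⟩ := hf.bounded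
    obtain ⟨D, hD⟩ := hg.bounded
    exact ⟨C * D, fun x => mul_le_mul' (hC x) (hD x)⟩
  bounded_support := hf.bounded_support.subset fun θ hθ => by
    simp only [Function.mem_support, ne_eq, mul_eq_zero, not_or] at hθ
    exact hθ.1

lemma exists_exhaustion (Θ : Type*) [MetricSpace Θ] [MeasurableSpace Θ] [OpensMeasurableSpace Θ] :
    ∃ S : ℕ → Set Θ, (∀ n, MeasurableSet (S n)) ∧ (∀ n, Bornology.IsBounded (S n)) ∧
      ∀ θ, ∀ᶠ n in atTop, θ ∈ S n := by
  rcases isEmpty_or_nonempty Θ with h | ⟨⟨x⟩⟩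
  · exact ⟨fun _ => ∅, by simp, by simp, fun θ => (h.false θ).elim⟩
  · refine ⟨fun n => Metric.ball x n, fun n => measurableSet_ball, fun n => Metric.isBounded_ball,
      fun θ => ?_⟩
    obtain ⟨N, hN⟩ := exists_nat_gt (dist θ x)
    filter_upwards [eventually_ge_atTop N] with n hn
    exact lt_of_lt_of_le hN (by exact_mod_cast hn)

variable {μ : Measure Ω} {H : Measure Θ} {c : ℝ≥0} {V M : Ω → Measure Θ}
  {f g : Θ → ℝ≥0}

namespace IsNCGammaMixture

lemma measurable_integral (h : IsNCGammaMixture μ H c V M) (hf : Measurable f) :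
    Measurable fun ω => ∫ θ, (f θ : ℝ) ∂V ω :=
  (measurable_integral_of_nonneg (q := fun θ => (f θ : ℝ)) (by fun_prop)
    fun θ => by positivity).comp h.measurable_left

lemma measurable_exponent (h : IsNCGammaMixture μ H c V M) (hf : Measurable f) :
    Measurable fun ω => laplaceExponent H (M ω) c f :=
  (measurable_laplaceExponent H c hf).comp h.measurable_right

lemma laplace_scaled (h : IsNCGammaMixture μ H c V M) (hf : IsBMPlus f) (s : ℝ≥0) :
    ∫ ω, Real.exp (-(s * ∫ θ, (f θ : ℝ) ∂V ω)) ∂μ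
      = ∫ ω, Real.exp (-laplaceExponent H (M ω) c fun θ => s * f θ) ∂μ := by
  have := h.laplace _ (hf.const_mul s)
  simpa only [ncGammaLaplace_eq, NNReal.coe_mul, integral_const_mul] using this

end IsNCGammaMixture

variable [OpensMeasurableSpace Θ]

/-- Truncation at height n on the n-th set of the exhaustion. At each point the value is eventually
exact. -/
lemma exists_bmPlus_approx (hf : Measurable f) :
    ∃ F : ℕ → Θ → ℝ≥0, (∀ n, IsBMPlus (F n)) ∧ (∀ n θ, F n θ ≤ f θ) ∧
      ∀ θ, ∀ᶠ n in atTop, F n θ = f θ := by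
  obtain ⟨S, hS, hSb, hSe⟩ := exists_exhaustion Θ
  refine ⟨fun n => (S n).indicator fun θ => min (f θ) n, fun n => ⟨?_, ⟨n, fun θ => ?_⟩, ?_⟩,
    fun n θ => ?_, fun θ => ?_⟩
  · exact (hf.min measurable_const).indicator (hS n)
  · exact Set.indicator_apply_le' (fun _ => min_le_right _ _) fun _ => zero_le
  · exact (hSb n).subset Set.support_indicator_subset
  · exact Set.indicator_apply_le' (fun _ => min_le_left _ _) fun _ => zero_le
  · obtain ⟨N, hN⟩ := exists_nat_ge (f θ)
    filter_upwards [eventually_ge_atTop N, hSe θ] with n hn hθ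
    rw [Set.indicator_of_mem hθ, min_eq_left]
    exact hN.trans (by exact_mod_cast hn)

lemma ofReal_integral_coe (hf : IsBMPlus f) {w : Measure Θ} (hw : FiniteOnBounded w) :
    ENNReal.ofReal (∫ θ, (f θ : ℝ) ∂w) = ∫⁻ θ, (f θ : ℝ≥0∞) ∂w := by
  rw [ofReal_integral_eq_lintegral_ofReal (hf.integrable hw)
    (Eventually.of_forall fun θ => NNReal.coe_nonneg _)]
  simp

namespace IsNCGammaMixture

variable [IsFiniteMeasure μ]

/-- Both sides are limits, as s → 0, of s⁻¹ times the mean of 1 minus the Laplace integrand at s f,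
and these means agree at every s > 0. -/
lemma lintegral_bmPlus (h : IsNCGammaMixture μ H c V M) (hf : IsBMPlus f) :
    ∫⁻ ω, ∫⁻ θ, f θ ∂V ω ∂μ = ∫⁻ ω, c * (∫⁻ θ, f θ ∂H + ∫⁻ θ, f θ ∂M ω) ∂μ := by
  obtain ⟨s, hs, hs0⟩ := exists_scale
  have hs' : ∀ n, 0 < (s n : ℝ) := fun n => by exact_mod_cast hs n
  have hVm := h.measurable_integral hf.measurable
  have hEm := fun n => h.measurable_exponent (hf.const_mul (s n)).measurable
  have hV0 : ∀ ω, 0 ≤ ∫ θ, (f θ : ℝ) ∂V ω := fun ω => integral_nonneg fun θ => by positivity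
  have hE0 := fun n ω => laplaceExponent_nonneg H (M ω) c fun θ => s n * f θ
  have hlim := fun ω => laplaceExponent_scaled h.base_finite (h.finite_right ω) c hf hs hs0
  have left : Tendsto (fun n => ∫⁻ ω, ENNReal.ofReal ((s n : ℝ)⁻¹ *
      (1 - Real.exp (-(s n * ∫ θ, (f θ : ℝ) ∂V ω)))) ∂μ) atTop
      (𝓝 (∫⁻ ω, ENNReal.ofReal (∫ θ, (f θ : ℝ) ∂V ω) ∂μ)) := by
    refine tendsto_lintegral_of_le (fun n => by fun_prop) (fun n ω => ?_) fun ω => ?_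
    · refine ENNReal.ofReal_le_ofReal ?_
      refine (mul_le_mul_of_nonneg_left (one_sub_exp_le _) (by positivity)).trans (le_of_eq ?_)
      have := hs' n
      field_simp
    · refine ENNReal.tendsto_ofReal (tendsto_mul_one_sub_exp
        (fun n => mul_nonneg (hs' n).le (hV0 ω)) (fun n => by positivity) ?_ ?_)
      · simpa using hs0.mul_const (∫ θ, (f θ : ℝ) ∂V ω)
      · refine tendsto_const_nhds.congr fun n => ?_
        have := hs' n
        field_simp
  have right : Tendsto (fun n => ∫⁻ ω, ENNReal.ofReal ((s n : ℝ)⁻¹ *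
      (1 - Real.exp (-laplaceExponent H (M ω) c fun θ => s n * f θ))) ∂μ) atTop
      (𝓝 (∫⁻ ω, ENNReal.ofReal (c * (∫ θ, (f θ : ℝ) ∂H + ∫ θ, (f θ : ℝ) ∂M ω)) ∂μ)) := by
    refine tendsto_lintegral_of_le (fun n => ?_) (fun n ω => ?_) fun ω => ?_
    · have := hEm n
      fun_prop
    · refine ENNReal.ofReal_le_ofReal ?_
      exact (mul_le_mul_of_nonneg_left (one_sub_exp_le _) (by positivity)).trans ((hlim ω).2.2 n)
    · refine ENNReal.tendsto_ofReal (tendsto_mul_one_sub_exp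
        (fun n => hE0 n ω) (fun n => by positivity) ?_ (hlim ω).1)
      -- The exponent itself tends to 0, being s times the convergent quotient.
      have := hs0.mul (hlim ω).1
      simpa [fun n => (hs' n).ne'] using this
  have eq : ∀ n, ∫⁻ ω, ENNReal.ofReal ((s n : ℝ)⁻¹ *
      (1 - Real.exp (-(s n * ∫ θ, (f θ : ℝ) ∂V ω)))) ∂μ = ∫⁻ ω, ENNReal.ofReal ((s n : ℝ)⁻¹ *
      (1 - Real.exp (-laplaceExponent H (M ω) c fun θ => s n * f θ))) ∂μ := fun n => by
    have i1 := integrable_exp_neg (μ := μ) (X := fun ω => s n * ∫ θ, (f θ : ℝ) ∂V ω)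
      (by fun_prop) fun ω => mul_nonneg (hs' n).le (hV0 ω)
    have i2 := integrable_exp_neg (μ := μ) (hEm n) (hE0 n)
    rw [← ofReal_integral_eq_lintegral_ofReal, ← ofReal_integral_eq_lintegral_ofReal,
      integral_const_mul, integral_const_mul, integral_sub (integrable_const _) i1,
      integral_sub (integrable_const _) i2, h.laplace_scaled hf]
    · exact ((integrable_const _).sub i2).const_mul _
    · refine Eventually.of_forall fun ω => mul_nonneg (by positivity) ?_
      simpa using hE0 n ω
    · exact ((integrable_const _).sub i1).const_mul _
    · refine Eventually.of_forall fun ω => mul_nonneg (by positivity) ?_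
      simpa using mul_nonneg (hs' n).le (hV0 ω)
  have main := tendsto_nhds_unique left (right.congr fun n => (eq n).symm)
  simp only [ofReal_integral_coe hf (h.finite_left _)] at main
  rw [main]
  congr with ω
  rw [ENNReal.ofReal_mul (by positivity), ENNReal.ofReal_add (integral_nonneg fun θ => by positivity)
    (integral_nonneg fun θ => by positivity), ofReal_integral_coe hf h.base_finite,
    ofReal_integral_coe hf (h.finite_right _), ENNReal.ofReal_coe_nnreal]

/-- A mixed second difference of the Laplace functional, at scales s f, s g and s(f + g), divided by
s². For V it factors as a product of two first differences. For the exponent, which is not additive,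
a correction involving `laplaceDefect` appears, and its limit is the conditional covariance. -/
lemma lintegral_mul_bmPlus (h : IsNCGammaMixture μ H c V M) (hf : IsBMPlus f) (hg : IsBMPlus g) :
    ∫⁻ ω, (∫⁻ θ, f θ ∂V ω) * (∫⁻ θ, g θ ∂V ω) ∂μ
      = ∫⁻ ω, (c * (∫⁻ θ, f θ ∂H + ∫⁻ θ, f θ ∂M ω) * (c * (∫⁻ θ, g θ ∂H + ∫⁻ θ, g θ ∂M ω))
        + (c ^ 2 * ∫⁻ θ, f θ * g θ ∂H + 2 * c ^ 2 * ∫⁻ θ, f θ * g θ ∂M ω)) ∂μ := by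
  obtain ⟨s, hs, hs0⟩ := exists_scale
  have hs' : ∀ n, 0 < (s n : ℝ) := fun n => by exact_mod_cast hs n
  have mV : ∀ {k : Θ → ℝ≥0}, IsBMPlus k → Measurable fun ω => ∫ θ, (k θ : ℝ) ∂V ω :=
    fun hk => h.measurable_integral hk.measurable
  have mE : ∀ n {k : Θ → ℝ≥0}, IsBMPlus k →
      Measurable fun ω => laplaceExponent H (M ω) c fun θ => s n * k θ :=
    fun n k hk => h.measurable_exponent (hk.const_mul (s n)).measurable
  have hV0 : ∀ (k : Θ → ℝ≥0) ω, 0 ≤ ∫ θ, (k θ : ℝ) ∂V ω :=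
    fun k ω => integral_nonneg fun θ => by positivity
  have hE0 := fun n (k : Θ → ℝ≥0) ω => laplaceExponent_nonneg H (M ω) c fun θ => s n * k θ
  have hlim : ∀ {k : Θ → ℝ≥0}, IsBMPlus k → ∀ ω, _ := fun hk ω =>
    laplaceExponent_scaled h.base_finite (h.finite_right ω) c hk hs hs0
  have hdef := fun ω => laplaceDefect_scaled h.base_finite (h.finite_right ω) c hf hg hs hs0
  have hz : ∀ {k : Θ → ℝ≥0}, IsBMPlus k → ∀ ω,
      Tendsto (fun n => laplaceExponent H (M ω) c fun θ => s n * k θ) atTop (𝓝 0) := fun hk ω => by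
    have := hs0.mul (hlim hk ω).1
    simpa [fun n => (hs' n).ne'] using this
  have hfg := hf.add hg
  have addV : ∀ ω, ∫ θ, ((f θ + g θ : ℝ≥0) : ℝ) ∂V ω
      = ∫ θ, (f θ : ℝ) ∂V ω + ∫ θ, (g θ : ℝ) ∂V ω := fun ω => by
    simp only [NNReal.coe_add]
    exact integral_add (hf.integrable (h.finite_left ω)) (hg.integrable (h.finite_left ω))
  -- The form on the left is a sum of nonnegative terms that converge separately. The form on the
  -- right is linear in exponentials, so the Laplace identity applies to it.
  have expE : ∀ n ω, (1 - Real.exp (-laplaceExponent H (M ω) c fun θ => s n * f θ))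
        * (1 - Real.exp (-laplaceExponent H (M ω) c fun θ => s n * g θ))
        + Real.exp (-laplaceExponent H (M ω) c fun θ => s n * (f θ + g θ))
          * (1 - Real.exp (-laplaceDefect H (M ω) c (fun θ => s n * f θ) fun θ => s n * g θ))
      = 1 - Real.exp (-laplaceExponent H (M ω) c fun θ => s n * f θ)
        - Real.exp (-laplaceExponent H (M ω) c fun θ => s n * g θ)
        + Real.exp (-laplaceExponent H (M ω) c fun θ => s n * (f θ + g θ)) := fun n ω => by
    have e : ∀ x y z : ℝ, Real.exp (-z) * (1 - Real.exp (-(x + y - z)))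
        = Real.exp (-z) - Real.exp (-x) * Real.exp (-y) := fun x y z => by
      rw [mul_sub, mul_one, ← Real.exp_add, ← Real.exp_add]
      ring_nf
    simp only [laplaceDefect, ← mul_add]
    rw [e]
    ring
  have expV : ∀ n ω, (1 - Real.exp (-(s n * ∫ θ, (f θ : ℝ) ∂V ω)))
        * (1 - Real.exp (-(s n * ∫ θ, (g θ : ℝ) ∂V ω)))
      = 1 - Real.exp (-(s n * ∫ θ, (f θ : ℝ) ∂V ω)) - Real.exp (-(s n * ∫ θ, (g θ : ℝ) ∂V ω))
        + Real.exp (-(s n * ∫ θ, ((f θ + g θ : ℝ≥0) : ℝ) ∂V ω)) := fun n ω => by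
    rw [addV, mul_add, neg_add, Real.exp_add]
    ring
  have nnE : ∀ n ω, 0 ≤ (1 - Real.exp (-laplaceExponent H (M ω) c fun θ => s n * f θ))
        * (1 - Real.exp (-laplaceExponent H (M ω) c fun θ => s n * g θ))
        + Real.exp (-laplaceExponent H (M ω) c fun θ => s n * (f θ + g θ))
          * (1 - Real.exp (-laplaceDefect H (M ω) c (fun θ => s n * f θ) fun θ => s n * g θ)) :=
    fun n ω => by
      have h1 : 0 ≤ 1 - Real.exp (-laplaceExponent H (M ω) c fun θ => s n * f θ) := by
        simpa using hE0 n _ ω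
      have h2 : 0 ≤ 1 - Real.exp (-laplaceExponent H (M ω) c fun θ => s n * g θ) := by
        simpa using hE0 n _ ω
      have h3 : 0 ≤ 1 - Real.exp (-laplaceDefect H (M ω) c (fun θ => s n * f θ)
          fun θ => s n * g θ) := by
        simpa using (hdef ω).2.1 n
      positivity
  have nnV : ∀ n (k : Θ → ℝ≥0) ω, 0 ≤ 1 - Real.exp (-(s n * ∫ θ, (k θ : ℝ) ∂V ω)) :=
    fun n k ω => by simpa using mul_nonneg (hs' n).le (hV0 k ω)
  have left : Tendsto (fun n => ∫⁻ ω, ENNReal.ofReal ((s n : ℝ)⁻¹ ^ 2 *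
      ((1 - Real.exp (-(s n * ∫ θ, (f θ : ℝ) ∂V ω)))
        * (1 - Real.exp (-(s n * ∫ θ, (g θ : ℝ) ∂V ω))))) ∂μ) atTop
      (𝓝 (∫⁻ ω, ENNReal.ofReal ((∫ θ, (f θ : ℝ) ∂V ω) * ∫ θ, (g θ : ℝ) ∂V ω) ∂μ)) := by
    have split : ∀ n ω, (s n : ℝ)⁻¹ ^ 2 * ((1 - Real.exp (-(s n * ∫ θ, (f θ : ℝ) ∂V ω)))
        * (1 - Real.exp (-(s n * ∫ θ, (g θ : ℝ) ∂V ω))))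
      = ((s n : ℝ)⁻¹ * (1 - Real.exp (-(s n * ∫ θ, (f θ : ℝ) ∂V ω))))
        * ((s n : ℝ)⁻¹ * (1 - Real.exp (-(s n * ∫ θ, (g θ : ℝ) ∂V ω)))) := fun n ω => by ring
    have hle : ∀ n (k : Θ → ℝ≥0) ω, (s n : ℝ)⁻¹ * (1 - Real.exp (-(s n * ∫ θ, (k θ : ℝ) ∂V ω)))
        ≤ ∫ θ, (k θ : ℝ) ∂V ω := fun n k ω => by
      refine (mul_le_mul_of_nonneg_left (one_sub_exp_le _) (by positivity)).trans (le_of_eq ?_)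
      have := hs' n
      field_simp
    have hto : ∀ (k : Θ → ℝ≥0) ω, Tendsto (fun n => (s n : ℝ)⁻¹ *
        (1 - Real.exp (-(s n * ∫ θ, (k θ : ℝ) ∂V ω)))) atTop (𝓝 (∫ θ, (k θ : ℝ) ∂V ω)) := by
      intro k ω
      refine tendsto_mul_one_sub_exp
        (fun n => mul_nonneg (hs' n).le (hV0 k ω)) (fun n => by positivity) ?_ ?_
      · simpa using hs0.mul_const (∫ θ, (k θ : ℝ) ∂V ω)
      · refine tendsto_const_nhds.congr fun n => ?_
        have := hs' n
        field_simp
    simp only [split]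
    have m1 := mV hf
    have m2 := mV hg
    refine tendsto_lintegral_of_le (fun n => by fun_prop) (fun n ω => ?_) fun ω => ?_
    · exact ENNReal.ofReal_le_ofReal (mul_le_mul (hle n f ω) (hle n g ω)
        (mul_nonneg (by positivity) (nnV n g ω)) (hV0 f ω))
    · exact ENNReal.tendsto_ofReal ((hto f ω).mul (hto g ω))
  have right : Tendsto (fun n => ∫⁻ ω, ENNReal.ofReal ((s n : ℝ)⁻¹ ^ 2 *
      ((1 - Real.exp (-laplaceExponent H (M ω) c fun θ => s n * f θ))
        * (1 - Real.exp (-laplaceExponent H (M ω) c fun θ => s n * g θ))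
        + Real.exp (-laplaceExponent H (M ω) c fun θ => s n * (f θ + g θ))
          * (1 - Real.exp (-laplaceDefect H (M ω) c (fun θ => s n * f θ) fun θ => s n * g θ))))
      ∂μ) atTop
      (𝓝 (∫⁻ ω, ENNReal.ofReal (c * (∫ θ, (f θ : ℝ) ∂H + ∫ θ, (f θ : ℝ) ∂M ω)
        * (c * (∫ θ, (g θ : ℝ) ∂H + ∫ θ, (g θ : ℝ) ∂M ω))
        + (c ^ 2 * ∫ θ, (f θ : ℝ) * g θ ∂H + 2 * c ^ 2 * ∫ θ, (f θ : ℝ) * g θ ∂M ω)) ∂μ)) := by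
    refine tendsto_lintegral_of_le (fun n => ?_) (fun n ω => ?_) fun ω => ?_
    · simp only [expE]
      have m1 := mE n hf
      have m2 := mE n hg
      have m3 := mE n hfg
      fun_prop
    · refine ENNReal.ofReal_le_ofReal ?_
      have b : ∀ {k : Θ → ℝ≥0}, IsBMPlus k → (s n : ℝ)⁻¹ *
          (1 - Real.exp (-laplaceExponent H (M ω) c fun θ => s n * k θ))
          ≤ c * (∫ θ, (k θ : ℝ) ∂H + ∫ θ, (k θ : ℝ) ∂M ω) := fun hk =>
        (mul_le_mul_of_nonneg_left (one_sub_exp_le _) (by positivity)).trans ((hlim hk ω).2.2 n)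
      have nb : ∀ {k : Θ → ℝ≥0}, IsBMPlus k → 0 ≤ (s n : ℝ)⁻¹ *
          (1 - Real.exp (-laplaceExponent H (M ω) c fun θ => s n * k θ)) := fun hk =>
        mul_nonneg (by positivity) (by simpa using hE0 n _ ω)
      have e1 := mul_le_mul (b hf) (b hg) (nb hg) ((nb hf).trans (b hf))
      -- The covariance part is bounded by its limit after the prefactor exp(-Ψ) is replaced by 1;
      -- the nonnegativity in `e3` permits this.
      have e2 := (mul_le_mul_of_nonneg_left (one_sub_exp_le
        (laplaceDefect H (M ω) c (fun θ => s n * f θ) fun θ => s n * g θ))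
        (sq_nonneg ((s n : ℝ)⁻¹))).trans ((hdef ω).2.2 n)
      have e3 : 0 ≤ (s n : ℝ)⁻¹ ^ 2 * (1 - Real.exp (-laplaceDefect H (M ω) c (fun θ => s n * f θ)
          fun θ => s n * g θ)) := mul_nonneg (by positivity) (by simpa using (hdef ω).2.1 n)
      have e4 : Real.exp (-laplaceExponent H (M ω) c fun θ => s n * (f θ + g θ)) ≤ 1 := by
        simpa using hE0 n _ ω
      have e5 := mul_le_mul_of_nonneg_right e4 e3
      linarith
    · refine ENNReal.tendsto_ofReal ?_
      have t : ∀ {k : Θ → ℝ≥0}, IsBMPlus k → _ := fun hk => tendsto_mul_one_sub_exp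
        (fun n => hE0 n _ ω) (fun n => by positivity) (hz hk ω) (hlim hk ω).1
      have t2 := tendsto_mul_one_sub_exp (fun n => (hdef ω).2.1 n) (fun n => by positivity) (by
        have := ((hz hf ω).add (hz hg ω)).sub (hz hfg ω)
        simpa [laplaceDefect, mul_add] using this) (hdef ω).1
      have t3 : Tendsto (fun n => Real.exp (-laplaceExponent H (M ω) c
          fun θ => s n * (f θ + g θ))) atTop (𝓝 1) := by
        simpa using ((hz hfg ω).neg).rexp
      have t4 := ((t hf).mul (t hg)).add (t3.mul t2)
      rw [one_mul] at t4
      refine t4.congr fun n => ?_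
      ring
  have eq : ∀ n, ∫⁻ ω, ENNReal.ofReal ((s n : ℝ)⁻¹ ^ 2 *
      ((1 - Real.exp (-(s n * ∫ θ, (f θ : ℝ) ∂V ω)))
        * (1 - Real.exp (-(s n * ∫ θ, (g θ : ℝ) ∂V ω))))) ∂μ = ∫⁻ ω, ENNReal.ofReal ((s n : ℝ)⁻¹ ^ 2 *
      ((1 - Real.exp (-laplaceExponent H (M ω) c fun θ => s n * f θ))
        * (1 - Real.exp (-laplaceExponent H (M ω) c fun θ => s n * g θ))
        + Real.exp (-laplaceExponent H (M ω) c fun θ => s n * (f θ + g θ))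
          * (1 - Real.exp (-laplaceDefect H (M ω) c (fun θ => s n * f θ) fun θ => s n * g θ))))
      ∂μ := fun n => by
    have iV : ∀ {k : Θ → ℝ≥0}, IsBMPlus k →
        Integrable (fun ω => Real.exp (-(s n * ∫ θ, (k θ : ℝ) ∂V ω))) μ := fun {k} hk =>
      integrable_exp_neg ((mV hk).const_mul _) fun ω => mul_nonneg (hs' n).le (hV0 k ω)
    have iE : ∀ {k : Θ → ℝ≥0}, IsBMPlus k →
        Integrable (fun ω => Real.exp (-laplaceExponent H (M ω) c fun θ => s n * k θ)) μ :=
      fun {k} hk => integrable_exp_neg (mE n hk) (hE0 n _)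
    have one : Integrable (fun _ : Ω => (1 : ℝ)) μ := integrable_const _
    have c1 : Integrable (fun ω => 1 - Real.exp (-(s n * ∫ θ, (f θ : ℝ) ∂V ω))) μ :=
      one.sub (iV hf)
    have c2 : Integrable (fun ω => 1 - Real.exp (-(s n * ∫ θ, (f θ : ℝ) ∂V ω))
      - Real.exp (-(s n * ∫ θ, (g θ : ℝ) ∂V ω))) μ := c1.sub (iV hg)
    have d1 : Integrable (fun ω => 1 - Real.exp (-laplaceExponent H (M ω) c
      fun θ => s n * f θ)) μ := one.sub (iE hf)
    have d2 : Integrable (fun ω => 1 - Real.exp (-laplaceExponent H (M ω) c fun θ => s n * f θ)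
      - Real.exp (-laplaceExponent H (M ω) c fun θ => s n * g θ)) μ := d1.sub (iE hg)
    rw [← ofReal_integral_eq_lintegral_ofReal, ← ofReal_integral_eq_lintegral_ofReal]
    · simp only [expE, expV]
      rw [integral_const_mul, integral_const_mul, integral_add c2 (iV hfg),
        integral_sub c1 (iV hg), integral_sub (integrable_const _) (iV hf),
        integral_add d2 (iE hfg), integral_sub d1 (iE hg), integral_sub (integrable_const _) (iE hf),
        h.laplace_scaled hf, h.laplace_scaled hg, h.laplace_scaled hfg]
    · simp only [expE]
      exact (d2.fun_add (iE hfg)).const_mul _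
    · exact Eventually.of_forall fun ω => mul_nonneg (by positivity) (nnE n ω)
    · simp only [expV]
      exact (c2.fun_add (iV hfg)).const_mul _
    · exact Eventually.of_forall fun ω => mul_nonneg (by positivity)
        (mul_nonneg (nnV n f ω) (nnV n g ω))
  have main := tendsto_nhds_unique left (right.congr fun n => (eq n).symm)
  have nn : ∀ (k : Θ → ℝ≥0) (w : Measure Θ), 0 ≤ ∫ θ, (k θ : ℝ) ∂w :=
    fun k w => integral_nonneg fun θ => by positivity
  have conv := fun {w : Measure Θ} (hw : FiniteOnBounded w) => ofReal_integral_coe (hf.mul hg) hw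
  simp only [NNReal.coe_mul, ENNReal.coe_mul] at conv
  have nn2 : ∀ w : Measure Θ, 0 ≤ ∫ θ, (f θ : ℝ) * g θ ∂w :=
    fun w => integral_nonneg fun θ => by positivity
  simp only [ENNReal.ofReal_mul (nn f _), ofReal_integral_coe hf (h.finite_left _),
    ofReal_integral_coe hg (h.finite_left _)] at main
  rw [main]
  congr with ω
  have n1 := nn f H
  have n2 := nn g H
  have n3 := nn f (M ω)
  have n4 := nn g (M ω)
  have n5 := nn2 H
  have n6 := nn2 (M ω)
  rw [ENNReal.ofReal_add (by positivity) (by positivity), ENNReal.ofReal_mul (by positivity),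
    ENNReal.ofReal_mul (by positivity), ENNReal.ofReal_mul (by positivity),
    ENNReal.ofReal_add n1 n3, ENNReal.ofReal_add n2 n4,
    ENNReal.ofReal_add (by positivity) (by positivity), ENNReal.ofReal_mul (by positivity),
    ENNReal.ofReal_mul (by positivity), ENNReal.ofReal_mul (by positivity),
    ofReal_integral_coe hf h.base_finite,
    ofReal_integral_coe hf (h.finite_right _), ofReal_integral_coe hg h.base_finite,
    ofReal_integral_coe hg (h.finite_right _), conv h.base_finite, conv (h.finite_right _),
    ENNReal.ofReal_pow (by positivity), ENNReal.ofReal_coe_nnreal, ENNReal.ofReal_ofNat]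

end IsNCGammaMixture

end Moments

/-! ### Extension of the moment formulas to all measurable functions. -/

section Extension

variable {Ω Θ : Type*} [MeasurableSpace Ω] [MetricSpace Θ] [MeasurableSpace Θ]
  [OpensMeasurableSpace Θ] {μ : Measure Ω} [IsFiniteMeasure μ] {H : Measure Θ} {c : ℝ≥0}
  {V M : Ω → Measure Θ} {f g : Θ → ℝ≥0}

lemma measurable_lintegral_coe {Θ : Type*} [MeasurableSpace Θ] {f : Θ → ℝ≥0} (hf : Measurable f) :
    Measurable fun w : Measure Θ => ∫⁻ θ, (f θ : ℝ≥0∞) ∂w :=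
  Measure.measurable_lintegral hf.coe_nnreal_ennreal

namespace IsNCGammaMixture

/-- First moments of a mixture of noncentral gamma processes. -/
lemma lintegral_eq (h : IsNCGammaMixture μ H c V M) (hf : Measurable f) :
    ∫⁻ ω, ∫⁻ θ, f θ ∂V ω ∂μ = ∫⁻ ω, c * (∫⁻ θ, f θ ∂H + ∫⁻ θ, f θ ∂M ω) ∂μ := by
  obtain ⟨F, hF, hFle, hFe⟩ := exists_bmPlus_approx hf
  have hm := fun n => measurable_lintegral_coe (hF n).measurable
  have lim : ∀ w : Measure Θ, Tendsto (fun n => ∫⁻ θ, (F n θ : ℝ≥0∞) ∂w) atTop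
      (𝓝 (∫⁻ θ, (f θ : ℝ≥0∞) ∂w)) := fun w =>
    tendsto_lintegral_of_le (fun n => (hF n).measurable.coe_nnreal_ennreal)
      (fun n θ => ENNReal.coe_le_coe.2 (hFle n θ))
      fun θ => tendsto_const_nhds.congr' ((hFe θ).mono fun n hn => by simp only [hn])
  have le : ∀ n (w : Measure Θ), ∫⁻ θ, (F n θ : ℝ≥0∞) ∂w ≤ ∫⁻ θ, (f θ : ℝ≥0∞) ∂w :=
    fun n w => lintegral_mono fun θ => ENNReal.coe_le_coe.2 (hFle n θ)
  have left := tendsto_lintegral_of_le (μ := μ) (fun n => (hm n).comp h.measurable_left)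
    (fun n ω => le n (V ω)) fun ω => lim (V ω)
  have right : Tendsto (fun n => ∫⁻ ω, c * (∫⁻ θ, (F n θ : ℝ≥0∞) ∂H + ∫⁻ θ, (F n θ : ℝ≥0∞) ∂M ω) ∂μ)
      atTop (𝓝 (∫⁻ ω, c * (∫⁻ θ, (f θ : ℝ≥0∞) ∂H + ∫⁻ θ, (f θ : ℝ≥0∞) ∂M ω) ∂μ)) :=
    tendsto_lintegral_of_le
      (fun n => (((hm n).comp h.measurable_right).const_add _).const_mul _)
      (fun n ω => by gcongr <;> exact hFle n _)
      fun ω => ENNReal.Tendsto.const_mul ((lim H).add (lim (M ω))) (Or.inr ENNReal.coe_ne_top)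
  exact tendsto_nhds_unique left (right.congr fun n => (h.lintegral_bmPlus (hF n)).symm)

/-- Second moments of a mixture of noncentral gamma processes. -/
lemma lintegral_mul_eq (h : IsNCGammaMixture μ H c V M) (hf : Measurable f) (hg : Measurable g) :
    ∫⁻ ω, (∫⁻ θ, f θ ∂V ω) * (∫⁻ θ, g θ ∂V ω) ∂μ
      = ∫⁻ ω, (c * (∫⁻ θ, f θ ∂H + ∫⁻ θ, f θ ∂M ω) * (c * (∫⁻ θ, g θ ∂H + ∫⁻ θ, g θ ∂M ω))
        + (c ^ 2 * ∫⁻ θ, f θ * g θ ∂H + 2 * c ^ 2 * ∫⁻ θ, f θ * g θ ∂M ω)) ∂μ := by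
  obtain ⟨F, hF, hFle, hFe⟩ := exists_bmPlus_approx hf
  obtain ⟨G, hG, hGle, hGe⟩ := exists_bmPlus_approx hg
  have hmF := fun n => measurable_lintegral_coe (hF n).measurable
  have hmG := fun n => measurable_lintegral_coe (hG n).measurable
  have hmFG : ∀ n, Measurable fun w : Measure Θ => ∫⁻ θ, (F n θ : ℝ≥0∞) * G n θ ∂w := fun n =>
    Measure.measurable_lintegral
      ((hF n).measurable.coe_nnreal_ennreal.mul (hG n).measurable.coe_nnreal_ennreal)
  have limF : ∀ w : Measure Θ, Tendsto (fun n => ∫⁻ θ, (F n θ : ℝ≥0∞) ∂w) atTop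
      (𝓝 (∫⁻ θ, (f θ : ℝ≥0∞) ∂w)) := fun w =>
    tendsto_lintegral_of_le (fun n => (hF n).measurable.coe_nnreal_ennreal)
      (fun n θ => ENNReal.coe_le_coe.2 (hFle n θ))
      fun θ => tendsto_const_nhds.congr' ((hFe θ).mono fun n hn => by simp only [hn])
  have limG : ∀ w : Measure Θ, Tendsto (fun n => ∫⁻ θ, (G n θ : ℝ≥0∞) ∂w) atTop
      (𝓝 (∫⁻ θ, (g θ : ℝ≥0∞) ∂w)) := fun w =>
    tendsto_lintegral_of_le (fun n => (hG n).measurable.coe_nnreal_ennreal)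
      (fun n θ => ENNReal.coe_le_coe.2 (hGle n θ))
      fun θ => tendsto_const_nhds.congr' ((hGe θ).mono fun n hn => by simp only [hn])
  have lePr : ∀ n θ, (F n θ : ℝ≥0∞) * G n θ ≤ f θ * g θ := fun n θ =>
    mul_le_mul' (ENNReal.coe_le_coe.2 (hFle n θ)) (ENNReal.coe_le_coe.2 (hGle n θ))
  have limFG : ∀ w : Measure Θ, Tendsto (fun n => ∫⁻ θ, (F n θ : ℝ≥0∞) * G n θ ∂w) atTop
      (𝓝 (∫⁻ θ, (f θ : ℝ≥0∞) * g θ ∂w)) := fun w =>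
    tendsto_lintegral_of_le (fun n => (hF n).measurable.coe_nnreal_ennreal.mul
      (hG n).measurable.coe_nnreal_ennreal) lePr
      fun θ => tendsto_const_nhds.congr' (by
        filter_upwards [hFe θ, hGe θ] with n h1 h2
        simp only [h1, h2])
  have leF : ∀ n (w : Measure Θ), ∫⁻ θ, (F n θ : ℝ≥0∞) ∂w ≤ ∫⁻ θ, (f θ : ℝ≥0∞) ∂w :=
    fun n w => lintegral_mono fun θ => ENNReal.coe_le_coe.2 (hFle n θ)
  have leG : ∀ n (w : Measure Θ), ∫⁻ θ, (G n θ : ℝ≥0∞) ∂w ≤ ∫⁻ θ, (g θ : ℝ≥0∞) ∂w :=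
    fun n w => lintegral_mono fun θ => ENNReal.coe_le_coe.2 (hGle n θ)
  have leFG : ∀ n (w : Measure Θ), ∫⁻ θ, (F n θ : ℝ≥0∞) * G n θ ∂w ≤ ∫⁻ θ, (f θ : ℝ≥0∞) * g θ ∂w :=
    fun n w => lintegral_mono (lePr n)
  have left := tendsto_lintegral_of_le (μ := μ)
    (fun n => ((hmF n).comp h.measurable_left).mul ((hmG n).comp h.measurable_left))
    (fun n ω => mul_le_mul' (leF n (V ω)) (leG n (V ω)))
    -- The factors may now be infinite, so products converge by domination rather than by
    -- continuity.
    fun ω => tendsto_mul_of_le (limF (V ω)) (limG (V ω)) (fun n => leF n _) fun n => leG n _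
  have right : Tendsto (fun n => ∫⁻ ω, (c * (∫⁻ θ, F n θ ∂H + ∫⁻ θ, F n θ ∂M ω)
        * (c * (∫⁻ θ, G n θ ∂H + ∫⁻ θ, G n θ ∂M ω))
        + (c ^ 2 * ∫⁻ θ, F n θ * G n θ ∂H + 2 * c ^ 2 * ∫⁻ θ, F n θ * G n θ ∂M ω)) ∂μ)
      atTop (𝓝 (∫⁻ ω, (c * (∫⁻ θ, f θ ∂H + ∫⁻ θ, f θ ∂M ω) * (c * (∫⁻ θ, g θ ∂H + ∫⁻ θ, g θ ∂M ω))
        + (c ^ 2 * ∫⁻ θ, f θ * g θ ∂H + 2 * c ^ 2 * ∫⁻ θ, f θ * g θ ∂M ω)) ∂μ)) := by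
    have c2 : (c : ℝ≥0∞) ^ 2 ≠ ∞ := by finiteness
    have c3 : 2 * (c : ℝ≥0∞) ^ 2 ≠ ∞ := by finiteness
    refine tendsto_lintegral_of_le (fun n => ?_) (fun n ω => ?_) fun ω => ?_
    · have m1 := (hmF n).comp h.measurable_right
      have m2 := (hmG n).comp h.measurable_right
      have m3 := (hmFG n).comp h.measurable_right
      exact (((m1.const_add _).const_mul _).mul ((m2.const_add _).const_mul _)).add
        ((m3.const_mul _).const_add _)
    · gcongr <;> first | exact hFle n _ | exact hGle n _
    · refine (tendsto_mul_of_le ?_ ?_ (fun n => ?_) fun n => ?_).add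
        ((ENNReal.Tendsto.const_mul (limFG H) (Or.inr c2)).add
          (ENNReal.Tendsto.const_mul (limFG (M ω)) (Or.inr c3)))
      · exact ENNReal.Tendsto.const_mul ((limF H).add (limF (M ω))) (Or.inr ENNReal.coe_ne_top)
      · exact ENNReal.Tendsto.const_mul ((limG H).add (limG (M ω))) (Or.inr ENNReal.coe_ne_top)
      · gcongr <;> exact hFle n _
      · gcongr <;> exact hGle n _
  exact tendsto_nhds_unique left
    (right.congr fun n => (h.lintegral_mul_bmPlus (hF n) (hG n)).symm)

end IsNCGammaMixture

end Extension

/-! ### One-step recursions for ρ_{s|t} and c_{s|t}. -/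

section Lag

variable (β c : ℕ → ℝ≥0)

@[simp] lemma rhoLag_self (t : ℕ) : rhoLag β c t t = 1 := by simp [rhoLag]

@[simp] lemma cLag_self (t : ℕ) : cLag β c t t = 0 := by simp [cLag]

lemma rhoLag_succ {s t : ℕ} (h : t ≤ s) :
    rhoLag β c (s + 1) t = β (s + 1) * c (s + 1) * rhoLag β c s t := by
  rw [rhoLag, rhoLag, Finset.prod_Ioc_succ_top h, mul_comm]

/-- The term j = s + 1 has an empty product and gives c_{s+1}; every earlier term acquires the
factor β_{s+1} c_{s+1}. -/
lemma cLag_succ {s t : ℕ} (h : t ≤ s) :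
    cLag β c (s + 1) t = c (s + 1) + β (s + 1) * c (s + 1) * cLag β c s t := by
  rw [cLag, cLag, Finset.sum_Ioc_succ_top h, Finset.Ioc_self, Finset.prod_empty, mul_one, add_comm,
    Finset.mul_sum]
  congr 1
  refine Finset.sum_congr rfl fun j hj => ?_
  rw [Finset.prod_Ioc_succ_top (Finset.mem_Ioc.1 hj).2]
  ring

end Lag

/-! ### The M-ARG(1) process: regression on the past and second moments. -/

lemma measurable_past {Ω Θ : Type*} [MeasurableSpace Θ] {W : ℕ → Ω → Measure Θ} {s t : ℕ}
     (hs : 1 ≤ s) (hst : s ≤ t) : Measurable[past W t] (W s) :=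
  measurable_iff_comap_le.2 (le_iSup₂_of_le s ⟨hs, hst⟩ le_rfl)

namespace IsMARG1

variable {Ω Θ : Type*} [mΩ : MeasurableSpace Ω] [MetricSpace Θ] [MeasurableSpace Θ]
  {P : Measure Ω} {H : Measure Θ} {β c : ℕ → ℝ≥0} {W : ℕ → Ω → Measure Θ}

lemma past_le (hW : IsMARG1 P H β c W) (t : ℕ) : past W t ≤ mΩ :=
  iSup₂_le fun s hs => (hW.measurable s hs.1).comap_le

lemma measurable_lintegral (hW : IsMARG1 P H β c W) {t : ℕ} (ht : 1 ≤ t) {f : Θ → ℝ≥0}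
    (hf : Measurable f) : Measurable fun ω => ∫⁻ θ, (f θ : ℝ≥0∞) ∂W t ω :=
  (measurable_lintegral_coe hf).comp (hW.measurable t ht)

variable [IsProbabilityMeasure P]

/-- Integrating the conditional Laplace functional over a past event A gives an unconditional
identity under P restricted to A. That measure has mass P(A), which is why mixtures are treated
under finite measures. -/
lemma isNCGammaMixture (hW : IsMARG1 P H β c W) {t : ℕ} (ht : 1 ≤ t) {A : Set Ω}
    (hA : MeasurableSet[past W t] A) :
    IsNCGammaMixture (P.restrict A) H (c (t + 1)) (W (t + 1)) fun ω => β (t + 1) • W t ω where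
  base_finite := hW.base_finite
  measurable_left := hW.measurable _ (by omega)
  measurable_right := by
    refine Measure.measurable_of_measurable_coe _ fun s hs => ?_
    simp only [Measure.smul_apply, ENNReal.smul_def, smul_eq_mul]
    exact ((Measure.measurable_coe hs).comp (hW.measurable t ht)).const_mul _
  finite_left := hW.finite _ (by omega)
  finite_right ω B hB := by
    simp only [Measure.smul_apply, ENNReal.smul_def, smul_eq_mul]
    exact ENNReal.mul_lt_top ENNReal.coe_lt_top (hW.finite t ht ω B hB)
  laplace f hf := by
    have hm : Measurable fun ω => ∫ θ, (f θ : ℝ) ∂W (t + 1) ω :=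
      (measurable_integral_of_nonneg (by have := hf.measurable; fun_prop)
        fun θ => by positivity).comp (hW.measurable (t + 1) (by omega))
    rw [← setIntegral_condExp (hW.past_le t) (integrable_exp_neg hm fun ω =>
      integral_nonneg fun θ => by positivity) hA]
    exact integral_congr_ae (ae_restrict_of_ae (hW.transition t ht f hf))

variable [OpensMeasurableSpace Θ]

/-- The two random variables multiplying Z have the same integral over every past event. As
densities they therefore define the same measure on the past σ-algebra, against which Z is
integrated. No conditional expectation of a possibly infinite variable is needed. -/
lemma lintegral_mul_succ (hW : IsMARG1 P H β c W) {t : ℕ} (ht : 1 ≤ t) {Z : Ω → ℝ≥0∞}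
    (hZ : Measurable[past W t] Z) {f : Θ → ℝ≥0} (hf : Measurable f) :
    ∫⁻ ω, Z ω * ∫⁻ θ, f θ ∂W (t + 1) ω ∂P
      = ∫⁻ ω, Z ω * (c (t + 1) * (∫⁻ θ, f θ ∂H + β (t + 1) * ∫⁻ θ, f θ ∂W t ω)) ∂P := by
  have hle := hW.past_le t
  have m1 := hW.measurable_lintegral (t := t + 1) (by omega) hf
  have m2 : Measurable fun ω => (c (t + 1) : ℝ≥0∞) *
      (∫⁻ θ, (f θ : ℝ≥0∞) ∂H + β (t + 1) * ∫⁻ θ, f θ ∂W t ω) :=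
    (((hW.measurable_lintegral ht hf).const_mul _).const_add _).const_mul _
  have key : (P.withDensity fun ω => ∫⁻ θ, (f θ : ℝ≥0∞) ∂W (t + 1) ω).trim hle
      = (P.withDensity fun ω => (c (t + 1) : ℝ≥0∞) *
      (∫⁻ θ, (f θ : ℝ≥0∞) ∂H + β (t + 1) * ∫⁻ θ, f θ ∂W t ω)).trim hle := by
    refine @Measure.ext _ (past W t) _ _ fun A hA => ?_
    rw [trim_measurableSet_eq hle hA, trim_measurableSet_eq hle hA,
      withDensity_apply _ (hle _ hA), withDensity_apply _ (hle _ hA),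
      (hW.isNCGammaMixture ht hA).lintegral_eq hf]
    congr with ω
    rw [lintegral_smul_measure, ENNReal.smul_def, smul_eq_mul]
  have e := congrArg (fun μ => @lintegral _ (past W t) μ Z) key
  simp only [lintegral_trim hle hZ, lintegral_withDensity_eq_lintegral_mul _ m1 (hZ.mono hle le_rfl),
    lintegral_withDensity_eq_lintegral_mul _ m2 (hZ.mono hle le_rfl), Pi.mul_apply] at e
  simpa only [mul_comm] using e

/-- The regression of `W s` on the past of `W` up to time `t`. -/
lemma lintegral_mul_lag (hW : IsMARG1 P H β c W) {t : ℕ} (ht : 1 ≤ t) {Z : Ω → ℝ≥0∞}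
    (hZ : Measurable[past W t] Z) {f : Θ → ℝ≥0} (hf : Measurable f) {s : ℕ} (hs : t ≤ s) :
    ∫⁻ ω, Z ω * ∫⁻ θ, f θ ∂W s ω ∂P
      = rhoLag β c s t * ∫⁻ ω, Z ω * ∫⁻ θ, f θ ∂W t ω ∂P
        + (∫⁻ ω, Z ω ∂P) * (cLag β c s t * ∫⁻ θ, f θ ∂H) := by
  have hZm : Measurable Z := hZ.mono (hW.past_le t) le_rfl
  induction s, hs using Nat.le_induction with
  | base => simp
  | succ s hs ih =>
    have hts : past W t ≤ past W s :=
      iSup₂_le fun r hr => le_iSup₂_of_le r ⟨hr.1, hr.2.trans hs⟩ le_rfl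
    have m : Measurable fun ω => Z ω * ∫⁻ θ, f θ ∂W s ω :=
      hZm.mul (hW.measurable_lintegral (ht.trans hs) hf)
    rw [hW.lintegral_mul_succ (ht.trans hs) (hZ.mono hts le_rfl) hf, rhoLag_succ β c hs,
      cLag_succ β c hs]
    -- Separates the immigration part, proportional to Z, from the autoregressive part, to which the
    -- induction hypothesis applies.
    have e : ∀ ω, Z ω * (c (s + 1) * (∫⁻ θ, (f θ : ℝ≥0∞) ∂H + β (s + 1) * ∫⁻ θ, f θ ∂W s ω))
        = (c (s + 1) * ∫⁻ θ, (f θ : ℝ≥0∞) ∂H) * Z ω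
          + c (s + 1) * β (s + 1) * (Z ω * ∫⁻ θ, f θ ∂W s ω) := fun ω => by ring
    simp only [e]
    rw [lintegral_add_left (hZm.const_mul _), lintegral_const_mul _ hZm,
      lintegral_const_mul _ m, ih]
    push_cast
    ring

lemma lintegral_lag (hW : IsMARG1 P H β c W) {f : Θ → ℝ≥0} (hf : Measurable f) {t : ℕ}
    (ht : 1 ≤ t) :
    ∫⁻ ω, ∫⁻ θ, f θ ∂W t ω ∂P
      = rhoLag β c t 1 * ∫⁻ ω, ∫⁻ θ, f θ ∂W 1 ω ∂P + cLag β c t 1 * ∫⁻ θ, f θ ∂H := by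
  have := hW.lintegral_mul_lag (Z := fun _ => 1) le_rfl measurable_const hf ht
  simpa using this

/-- The second moments of `W t`. -/
lemma lintegral_mul_self (hW : IsMARG1 P H β c W) {f g : Θ → ℝ≥0} (hf : Measurable f)
    (hg : Measurable g) {t : ℕ} (ht : 1 ≤ t) :
    ∫⁻ ω, (∫⁻ θ, f θ ∂W t ω) * ∫⁻ θ, g θ ∂W t ω ∂P
      = cLag β c t 1 ^ 2 * ((∫⁻ θ, f θ ∂H) * ∫⁻ θ, g θ ∂H)
        + cLag β c t 1 * rhoLag β c t 1 * ((∫⁻ θ, f θ ∂H) * ∫⁻ ω, ∫⁻ θ, g θ ∂W 1 ω ∂P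
          + (∫⁻ ω, ∫⁻ θ, f θ ∂W 1 ω ∂P) * ∫⁻ θ, g θ ∂H)
        + rhoLag β c t 1 ^ 2 * ∫⁻ ω, (∫⁻ θ, f θ ∂W 1 ω) * ∫⁻ θ, g θ ∂W 1 ω ∂P
        + cLag β c t 1 ^ 2 * ∫⁻ θ, f θ * g θ ∂H
        + 2 * rhoLag β c t 1 * cLag β c t 1 * ∫⁻ ω, ∫⁻ θ, f θ * g θ ∂W 1 ω ∂P := by
  induction t, ht using Nat.le_induction with
  | base => simp
  | succ t ht ih =>
    have mf := hW.measurable_lintegral ht hf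
    have mg := hW.measurable_lintegral ht hg
    have mprod : Measurable fun ω => (∫⁻ θ, (f θ : ℝ≥0∞) ∂W t ω) * ∫⁻ θ, g θ ∂W t ω := mf.mul mg
    have mfg := hW.measurable_lintegral ht (hf.mul hg)
    have hmix := hW.isNCGammaMixture ht (A := Set.univ) MeasurableSet.univ
    have h := hmix.lintegral_mul_eq hf hg
    rw [Measure.restrict_univ] at h
    have hfg := hW.lintegral_lag (hf.mul hg) ht
    simp only [Pi.mul_apply, ENNReal.coe_mul] at hfg mfg
    rw [h, rhoLag_succ β c ht, cLag_succ β c ht]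
    simp only [lintegral_smul_measure, ENNReal.smul_def, smul_eq_mul]
    -- The one-step second moment is affine in ∫ f dW_t, ∫ g dW_t, their product and ∫ fg dW_t.
    -- Writing C = c_{t|1}, c = c_{t+1}, β = β_{t+1}, the new coefficient of H(fg) is c² + 2c²βC +
    -- (βc)²C² = (c + βcC)², so it stays the square of c_{t+1|1}. That of W̄₁(fg) closes up in the
    -- same way.
    have e : ∀ ω, (c (t + 1) * (∫⁻ θ, (f θ : ℝ≥0∞) ∂H + β (t + 1) * ∫⁻ θ, f θ ∂W t ω) *
          (c (t + 1) * (∫⁻ θ, (g θ : ℝ≥0∞) ∂H + β (t + 1) * ∫⁻ θ, g θ ∂W t ω))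
        + (c (t + 1) ^ 2 * ∫⁻ θ, (f θ : ℝ≥0∞) * g θ ∂H
          + 2 * c (t + 1) ^ 2 * (β (t + 1) * ∫⁻ θ, (f θ : ℝ≥0∞) * g θ ∂W t ω)) : ℝ≥0∞)
        = (c (t + 1) ^ 2 * ((∫⁻ θ, (f θ : ℝ≥0∞) ∂H) * ∫⁻ θ, (g θ : ℝ≥0∞) ∂H)
            + c (t + 1) ^ 2 * ∫⁻ θ, (f θ : ℝ≥0∞) * g θ ∂H)
          + (c (t + 1) ^ 2 * β (t + 1) * (∫⁻ θ, (f θ : ℝ≥0∞) ∂H)) * (∫⁻ θ, (g θ : ℝ≥0∞) ∂W t ω)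
          + (c (t + 1) ^ 2 * β (t + 1) * (∫⁻ θ, (g θ : ℝ≥0∞) ∂H)) * (∫⁻ θ, (f θ : ℝ≥0∞) ∂W t ω)
          + (c (t + 1) ^ 2 * β (t + 1) ^ 2) *
            ((∫⁻ θ, (f θ : ℝ≥0∞) ∂W t ω) * ∫⁻ θ, (g θ : ℝ≥0∞) ∂W t ω)
          + (2 * c (t + 1) ^ 2 * β (t + 1)) * ∫⁻ θ, (f θ : ℝ≥0∞) * g θ ∂W t ω := fun ω => by ring
    simp only [e]
    rw [lintegral_add_right _ (mfg.const_mul _), lintegral_add_right _ (mprod.const_mul _),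
      lintegral_add_right _ (mf.const_mul _), lintegral_add_right _ (mg.const_mul _),
      lintegral_const, measure_univ, mul_one, lintegral_const_mul _ mg, lintegral_const_mul _ mf,
      lintegral_const_mul _ mprod, lintegral_const_mul _ mfg, ih, hfg,
      hW.lintegral_lag hf ht, hW.lintegral_lag hg ht]
    push_cast
    ring

end IsMARG1

/-! ### Joint measurability of integrals against random measures. -/

section JointMeasurability

variable {Z Θ : Type*} [MeasurableSpace Z] [MeasurableSpace Θ]

/-- Each measure is finite, but with no bound uniform in z, so `V` need not be a finite kernel.
Functional induction starts from the measurability of the masses of sections. -/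
lemma measurable_lintegral_of_finite {V : Z → Measure Θ} (hV : Measurable V)
    (hfin : ∀ z, IsFiniteMeasure (V z)) {φ : Z × Θ → ℝ≥0∞} (hφ : Measurable φ) :
    Measurable fun z => ∫⁻ θ, φ (z, θ) ∂V z := by
  refine Measurable.ennreal_induction (motive := fun φ : Z × Θ → ℝ≥0∞ =>
    Measurable fun z => ∫⁻ θ, φ (z, θ) ∂V z) (fun a s hs => ?_)
    (fun φ ψ _ hφ hψ h1 h2 => ?_) (fun φ hφ hmono h => ?_) hφ
  · have e : ∀ z, ∫⁻ θ, s.indicator (fun _ => a) (z, θ) ∂V z = a * V z (Prod.mk z ⁻¹' s) :=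
      fun z => by
        rw [← lintegral_indicator_const (measurable_prodMk_left hs)]
        rfl
    simp only [e]
    exact (Kernel.measurable_kernel_prodMk_left_of_finite (κ := ⟨V, hV⟩) hs hfin).const_mul a
  · have e : ∀ z, ∫⁻ θ, (φ + ψ) (z, θ) ∂V z
        = ∫⁻ θ, φ (z, θ) ∂V z + ∫⁻ θ, ψ (z, θ) ∂V z := fun z =>
      lintegral_add_left (hφ.comp measurable_prodMk_left) _
    simp only [e]
    exact h1.add h2
  · have e : ∀ z, ∫⁻ θ, ⨆ n, φ n (z, θ) ∂V z = ⨆ n, ∫⁻ θ, φ n (z, θ) ∂V z := fun z =>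
      lintegral_iSup (fun n => (hφ n).comp measurable_prodMk_left) fun i j hij θ => hmono hij _
    simp only [e]
    exact Measurable.iSup h

variable [MetricSpace Θ] [OpensMeasurableSpace Θ]

lemma measurable_lintegral_of_finiteOnBounded {V : Z → Measure Θ} (hV : Measurable V)
    (hfin : ∀ z, FiniteOnBounded (V z)) {φ : Z × Θ → ℝ≥0∞} (hφ : Measurable φ) :
    Measurable fun z => ∫⁻ θ, φ (z, θ) ∂V z := by
  obtain ⟨S, hS, hSb, hSe⟩ := exists_exhaustion Θ
  have hr : ∀ n, Measurable fun z => (V z).restrict (S n) := fun n => by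
    refine Measure.measurable_of_measurable_coe _ fun s hs => ?_
    simp only [Measure.restrict_apply hs]
    exact (Measure.measurable_coe (hs.inter (hS n))).comp hV
  refine ENNReal.measurable_of_tendsto (f := fun n z => ∫⁻ θ, φ (z, θ) ∂(V z).restrict (S n))
    (fun n => measurable_lintegral_of_finite (hr n)
      (fun z => ⟨by simpa using hfin z _ (hSb n)⟩) hφ) (tendsto_pi_nhds.2 fun z => ?_)
  simp only [← lintegral_indicator (hS _)]
  refine tendsto_lintegral_of_le
    (fun n => (hφ.comp measurable_prodMk_left).indicator (hS n))
    (fun n θ => Set.indicator_le_self _ _ θ) fun θ => ?_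
  exact tendsto_const_nhds.congr' ((hSe θ).mono fun n hn => (Set.indicator_of_mem hn _).symm)

end JointMeasurability

/-! ### Moments of mixed Poisson variables. -/

section PoissonMoments

lemma poissonWeight_nonneg (m : ℝ≥0∞) (k : ℕ) : 0 ≤ poissonWeight m k := by
  unfold poissonWeight
  split_ifs
  · exact le_rfl
  · exact measureReal_nonneg

lemma poissonWeight_coe (m : ℝ≥0) (k : ℕ) :
    poissonWeight m k = Real.exp (-m) * m ^ k / k.factorial := by
  simp [poissonWeight, poissonMeasure_real_singleton]

lemma measurable_poissonWeight (k : ℕ) : Measurable fun m => poissonWeight m k := by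
  unfold poissonWeight
  simp only [poissonMeasure_real_singleton]
  exact Measurable.ite (measurableSet_singleton _) measurable_const (by fun_prop)

lemma tsum_poissonWeight {m : ℝ≥0∞} (hm : m ≠ ∞) :
    ∑' k, ENNReal.ofReal (poissonWeight m k) = 1 := by
  lift m to ℝ≥0 using hm
  have h := hasSum_one_poissonMeasure m
  simp only [← poissonWeight_coe] at h
  rw [← ENNReal.ofReal_tsum_of_nonneg (fun k => poissonWeight_nonneg _ _) h.summable, h.tsum_eq,
    ENNReal.ofReal_one]

/-- This recurrence turns both moment sums into index shifts: one use gives the mean, and a second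
gives m² + m. -/
lemma succ_mul_poissonWeight {m : ℝ≥0∞} (hm : m ≠ ∞) (k : ℕ) :
    ((k + 1 : ℕ) : ℝ≥0∞) * ENNReal.ofReal (poissonWeight m (k + 1))
      = m * ENNReal.ofReal (poissonWeight m k) := by
  lift m to ℝ≥0 using hm
  rw [← ENNReal.ofReal_natCast, ← ENNReal.ofReal_coe_nnreal, ← ENNReal.ofReal_mul (by positivity),
    ← ENNReal.ofReal_mul (by positivity), ENNReal.ofReal_coe_nnreal, poissonWeight_coe,
    poissonWeight_coe, Nat.factorial_succ]
  congr 1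
  push_cast
  field_simp
  exact pow_succ' _ _

lemma tsum_mul_poissonWeight {m : ℝ≥0∞} (hm : m ≠ ∞) :
    ∑' k : ℕ, (k : ℝ≥0∞) * ENNReal.ofReal (poissonWeight m k) = m := by
  rw [tsum_eq_zero_add' ENNReal.summable]
  simp only [succ_mul_poissonWeight hm, ENNReal.tsum_mul_left, tsum_poissonWeight hm]
  simp

lemma tsum_sq_mul_poissonWeight {m : ℝ≥0∞} (hm : m ≠ ∞) :
    ∑' k : ℕ, (k : ℝ≥0∞) * k * ENNReal.ofReal (poissonWeight m k) = m * m + m := by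
  rw [tsum_eq_zero_add' ENNReal.summable]
  simp only [mul_assoc, succ_mul_poissonWeight hm]
  have e : ∀ k : ℕ, ((k + 1 : ℕ) : ℝ≥0∞) * (m * ENNReal.ofReal (poissonWeight m k))
      = m * (k * ENNReal.ofReal (poissonWeight m k)) + m * ENNReal.ofReal (poissonWeight m k) :=
    fun k => by push_cast; ring
  simp only [e]
  rw [ENNReal.tsum_add, ENNReal.tsum_mul_left, ENNReal.tsum_mul_left, tsum_poissonWeight hm,
    tsum_mul_poissonWeight hm]
  simp

variable {Ω : Type*} [MeasurableSpace Ω] {P : Measure Ω} [IsProbabilityMeasure P]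

/-- The values of X are not assumed to be integers. Almost surely finite means make the weights sum
to 1, so the events X = k exhaust the probability. -/
lemma ae_exists_natCast {X m : Ω → ℝ≥0∞} (hX : Measurable X) (hm : Measurable m)
    (hfin : ∀ᵐ ω ∂P, m ω ≠ ∞)
    (h : ∀ k : ℕ, P {ω | X ω = k} = ∫⁻ ω, ENNReal.ofReal (poissonWeight (m ω) k) ∂P) :
    ∀ᵐ ω ∂P, ∃ k : ℕ, X ω = k := by
  have hs : ∀ k : ℕ, MeasurableSet {ω | X ω = k} := fun k => hX (measurableSet_singleton _)
  have e : {ω | ∃ k : ℕ, X ω = k} = ⋃ k : ℕ, {ω | X ω = k} := by ext; simp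
  have h1 : P {ω | ∃ k : ℕ, X ω = k} = 1 := by
    rw [e, measure_iUnion _ hs]
    · simp only [h]
      rw [← lintegral_tsum (f := fun k ω => ENNReal.ofReal (poissonWeight (m ω) k)) fun k =>
        ((measurable_poissonWeight k).comp hm).ennreal_ofReal.aemeasurable,
        lintegral_congr_ae (g := fun _ => 1) (hfin.mono fun ω hω => tsum_poissonWeight hω)]
      simp
    · intro i j hij
      refine Set.disjoint_left.2 fun ω hi hj => hij ?_
      simp only [Set.mem_ofPred_eq] at hi hj
      exact_mod_cast hi.symm.trans hj
  exact (prob_compl_eq_zero_iff (by rw [e]; exact MeasurableSet.iUnion hs)).2 h1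

lemma lintegral_comp_of_poisson {X m : Ω → ℝ≥0∞} (hX : Measurable X) (hm : Measurable m)
    (hfin : ∀ᵐ ω ∂P, m ω ≠ ∞)
    (h : ∀ k : ℕ, P {ω | X ω = k} = ∫⁻ ω, ENNReal.ofReal (poissonWeight (m ω) k) ∂P)
    (g : ℝ≥0∞ → ℝ≥0∞) :
    ∫⁻ ω, g (X ω) ∂P
      = ∫⁻ ω, ∑' k : ℕ, g k * ENNReal.ofReal (poissonWeight (m ω) k) ∂P := by
  have hs : ∀ k : ℕ, MeasurableSet {ω | X ω = k} := fun k => hX (measurableSet_singleton _)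
  have hw : ∀ k, Measurable fun ω => ENNReal.ofReal (poissonWeight (m ω) k) := fun k =>
    ((measurable_poissonWeight k).comp hm).ennreal_ofReal
  calc ∫⁻ ω, g (X ω) ∂P
      = ∫⁻ ω, ∑' k : ℕ, {ω | X ω = k}.indicator (fun _ => g k) ω ∂P := by
        refine lintegral_congr_ae ((ae_exists_natCast hX hm hfin h).mono ?_)
        rintro ω ⟨k, hk⟩
        simp only
        rw [tsum_eq_single k, Set.indicator_of_mem (by exact hk), hk]
        intro j hj
        refine Set.indicator_of_notMem (fun hj' => hj ?_) _
        simp only [Set.mem_ofPred_eq] at hj'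
        exact_mod_cast hj'.symm.trans hk
    _ = ∑' k : ℕ, g k * ∫⁻ ω, ENNReal.ofReal (poissonWeight (m ω) k) ∂P := by
        rw [lintegral_tsum fun k => (measurable_const.indicator (hs k)).aemeasurable]
        simp only [lintegral_indicator_const (hs _), h]
    _ = _ := by
        rw [lintegral_tsum fun k => ((hw k).const_mul _).aemeasurable]
        simp only [lintegral_const_mul _ (hw _)]

/-- Sum over the pairs of values. The joint weights factor, so the double series is a product of two
Poisson means. -/
lemma lintegral_mul_of_poisson {X₁ X₂ m₁ m₂ : Ω → ℝ≥0∞} (hX₁ : Measurable X₁) (hX₂ : Measurable X₂)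
    (hm₁ : Measurable m₁) (hm₂ : Measurable m₂)
    (hfin₁ : ∀ᵐ ω ∂P, m₁ ω ≠ ∞) (hfin₂ : ∀ᵐ ω ∂P, m₂ ω ≠ ∞)
    (h₁ : ∀ k : ℕ, P {ω | X₁ ω = k} = ∫⁻ ω, ENNReal.ofReal (poissonWeight (m₁ ω) k) ∂P)
    (h₂ : ∀ k : ℕ, P {ω | X₂ ω = k} = ∫⁻ ω, ENNReal.ofReal (poissonWeight (m₂ ω) k) ∂P)
    (h : ∀ k l : ℕ, P {ω | X₁ ω = k ∧ X₂ ω = l} = ∫⁻ ω, ENNReal.ofReal (poissonWeight (m₁ ω) k) *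
      ENNReal.ofReal (poissonWeight (m₂ ω) l) ∂P) :
    ∫⁻ ω, X₁ ω * X₂ ω ∂P = ∫⁻ ω, m₁ ω * m₂ ω ∂P := by
  have hs : ∀ k l : ℕ, MeasurableSet {ω | X₁ ω = k ∧ X₂ ω = l} := fun k l =>
    (hX₁ (measurableSet_singleton _)).inter (hX₂ (measurableSet_singleton _))
  have hw : ∀ k l, Measurable fun ω => ENNReal.ofReal (poissonWeight (m₁ ω) k) *
      ENNReal.ofReal (poissonWeight (m₂ ω) l) := fun k l =>
    ((measurable_poissonWeight k).comp hm₁).ennreal_ofReal.mul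
      ((measurable_poissonWeight l).comp hm₂).ennreal_ofReal
  calc ∫⁻ ω, X₁ ω * X₂ ω ∂P
      = ∫⁻ ω, ∑' p : ℕ × ℕ, {ω | X₁ ω = p.1 ∧ X₂ ω = p.2}.indicator
          (fun _ => (p.1 : ℝ≥0∞) * p.2) ω ∂P := by
        refine lintegral_congr_ae ?_
        filter_upwards [ae_exists_natCast hX₁ hm₁ hfin₁ h₁, ae_exists_natCast hX₂ hm₂ hfin₂ h₂]
        rintro ω ⟨k, hk⟩ ⟨l, hl⟩
        rw [tsum_eq_single (k, l), Set.indicator_of_mem (by exact ⟨hk, hl⟩), hk, hl]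
        rintro ⟨i, j⟩ hij
        refine Set.indicator_of_notMem (fun hj' => hij ?_) _
        simp only [Set.mem_ofPred_eq] at hj'
        exact Prod.ext (by exact_mod_cast hj'.1.symm.trans hk) (by exact_mod_cast hj'.2.symm.trans hl)
    _ = ∑' p : ℕ × ℕ, (p.1 : ℝ≥0∞) * p.2 * ∫⁻ ω, ENNReal.ofReal (poissonWeight (m₁ ω) p.1) *
          ENNReal.ofReal (poissonWeight (m₂ ω) p.2) ∂P := by
        rw [lintegral_tsum (f := fun (p : ℕ × ℕ) => {ω | X₁ ω = p.1 ∧ X₂ ω = p.2}.indicator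
          fun _ => (p.1 : ℝ≥0∞) * p.2)
          fun p => (measurable_const.indicator (hs p.1 p.2)).aemeasurable]
        simp only [lintegral_indicator_const (hs _ _), h]
    _ = ∫⁻ ω, ∑' p : ℕ × ℕ, (p.1 : ℝ≥0∞) * p.2 * (ENNReal.ofReal (poissonWeight (m₁ ω) p.1) *
          ENNReal.ofReal (poissonWeight (m₂ ω) p.2)) ∂P := by
        rw [lintegral_tsum (f := fun (p : ℕ × ℕ) ω => (p.1 : ℝ≥0∞) * p.2 *
          (ENNReal.ofReal (poissonWeight (m₁ ω) p.1) * ENNReal.ofReal (poissonWeight (m₂ ω) p.2)))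
          fun p => ((hw p.1 p.2).const_mul _).aemeasurable]
        simp only [lintegral_const_mul _ (hw _ _)]
    _ = _ := by
        refine lintegral_congr_ae ?_
        filter_upwards [hfin₁, hfin₂] with ω hω₁ hω₂
        rw [ENNReal.tsum_prod (f := fun k l : ℕ => (k : ℝ≥0∞) * l *
          (ENNReal.ofReal (poissonWeight (m₁ ω) k) * ENNReal.ofReal (poissonWeight (m₂ ω) l)))]
        have e : ∀ k l : ℕ, (k : ℝ≥0∞) * l * (ENNReal.ofReal (poissonWeight (m₁ ω) k) *
            ENNReal.ofReal (poissonWeight (m₂ ω) l)) = (k * ENNReal.ofReal (poissonWeight (m₁ ω) k))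
            * (l * ENNReal.ofReal (poissonWeight (m₂ ω) l)) := fun k l => by ring
        simp only [e, ENNReal.tsum_mul_left, ENNReal.tsum_mul_right, tsum_mul_poissonWeight hω₁,
          tsum_mul_poissonWeight hω₂]

end PoissonMoments

/-! ### Laws of the counts and measurability of the random intensity. -/

lemma intensityMeasure_apply {Y Θ : Type*} [MeasurableSpace Y] [MeasurableSpace Θ]
    {K : Y → Θ → ℝ≥0} {ℓ : Measure Y} (a : ℝ≥0) (w : Measure Θ) {B : Set Y} (hB : MeasurableSet B) :
    intensityMeasure K ℓ a w B = ∫⁻ y in B, a * shotNoise K w y ∂ℓ :=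
  withDensity_apply _ hB

namespace IsSNMARG1

variable {Ω Y Θ : Type*} [mΩ : MeasurableSpace Ω] [MetricSpace Y] [MeasurableSpace Y]
  [MetricSpace Θ] [MeasurableSpace Θ]
  {P : Measure Ω} {H : Measure Θ} {β c κ : ℕ → ℝ≥0} {K : Y → Θ → ℝ≥0}
  {ℓ : Measure Y} {W : ℕ → Ω → Measure Θ} {N : ℕ → Ω → Measure Y}

lemma measurable_kernel_section (hN : IsSNMARG1 P H β c κ K ℓ W N) (y : Y) :
    Measurable (K y) :=
  hN.kernel_measurable.comp measurable_prodMk_left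

section Count

variable [IsProbabilityMeasure P]

lemma measure_count (hN : IsSNMARG1 P H β c κ K ℓ W N) {n : ℕ} {τ : Fin n → ℕ} {B : Fin n → Set Y}
    (k : Fin n → ℕ) (hτ : ∀ i, 1 ≤ τ i) (hB : ∀ i, MeasurableSet (B i))
    (hBb : ∀ i, Bornology.IsBounded (B i))
    (hd : ∀ i j, i ≠ j → τ i = τ j → Disjoint (B i) (B j)) :
    P {ω | ∀ i, N (τ i) ω (B i) = (k i : ℝ≥0∞)} = ∫⁻ ω, ENNReal.ofReal
      (∏ i, poissonWeight (intensityMeasure K ℓ (κ (τ i)) (W (τ i) ω) (B i)) (k i)) ∂P := by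
  have hle : fullHistory W ≤ mΩ := iSup₂_le fun s hs => (hN.marg.measurable s hs).comap_le
  have hs : MeasurableSet {ω | ∀ i, N (τ i) ω (B i) = (k i : ℝ≥0∞)} := by
    simp only [Set.ofPred_forall]
    exact MeasurableSet.iInter fun i => ((Measure.measurable_coe (hB i)).comp
      (hN.measurable _ (hτ i))) (measurableSet_singleton _)
  have hp := hN.poisson n τ B k hτ hB hBb hd
  -- The product of Poisson weights inherits integrability from the conditional expectation it
  -- equals almost everywhere.
  have hi := integrable_condExp.congr hp
  rw [← ofReal_integral_eq_lintegral_ofReal hi (Eventually.of_forall fun ω =>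
    Finset.prod_nonneg fun i _ => poissonWeight_nonneg _ _), ← integral_congr_ae hp,
    integral_condExp hle, integral_indicator_const _ hs]
  simp

lemma measure_count_one (hN : IsSNMARG1 P H β c κ K ℓ W N) {t : ℕ} (ht : 1 ≤ t) {B : Set Y}
    (hB : MeasurableSet B) (hBb : Bornology.IsBounded B) (k : ℕ) :
    P {ω | N t ω B = k} = ∫⁻ ω, ENNReal.ofReal
      (poissonWeight (intensityMeasure K ℓ (κ t) (W t ω) B) k) ∂P := by
  have := hN.measure_count (n := 1) (τ := fun _ => t) (B := fun _ => B) (fun _ => k)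
    (fun _ => ht) (fun _ => hB) (fun _ => hBb) fun i j hij => (hij (Subsingleton.elim i j)).elim
  simpa using this

lemma measure_count_two (hN : IsSNMARG1 P H β c κ K ℓ W N) {s t : ℕ} (hs : 1 ≤ s) (ht : 1 ≤ t)
    {B₁ B₂ : Set Y} (hB₁ : MeasurableSet B₁) (hb₁ : Bornology.IsBounded B₁)
    (hB₂ : MeasurableSet B₂) (hb₂ : Bornology.IsBounded B₂) (hd : s = t → Disjoint B₁ B₂)
    (k l : ℕ) :
    P {ω | N s ω B₁ = k ∧ N t ω B₂ = l} = ∫⁻ ω,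
      ENNReal.ofReal (poissonWeight (intensityMeasure K ℓ (κ s) (W s ω) B₁) k) *
      ENNReal.ofReal (poissonWeight (intensityMeasure K ℓ (κ t) (W t ω) B₂) l) ∂P := by
  have := hN.measure_count (n := 2) (τ := ![s, t]) (B := ![B₁, B₂]) ![k, l]
    (Fin.forall_fin_two.2 ⟨hs, ht⟩) (Fin.forall_fin_two.2 ⟨hB₁, hB₂⟩)
    (Fin.forall_fin_two.2 ⟨hb₁, hb₂⟩) (Fin.forall_fin_two.2 ⟨Fin.forall_fin_two.2
      ⟨fun h => (h rfl).elim, fun _ h => hd h⟩, Fin.forall_fin_two.2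
      ⟨fun _ h => (hd h.symm).symm, fun h => (h rfl).elim⟩⟩)
  simpa [Fin.forall_fin_two, Fin.prod_univ_two, ENNReal.ofReal_mul (poissonWeight_nonneg _ _)]
    using this

end Count

variable [OpensMeasurableSpace Θ]

lemma measurable_shotNoise (hN : IsSNMARG1 P H β c κ K ℓ W N) {t : ℕ} (ht : 1 ≤ t) :
    Measurable fun p : Ω × Y => shotNoise K (W t p.1) p.2 := by
  refine measurable_lintegral_of_finiteOnBounded (Z := Ω × Y) (V := fun p => W t p.1)
    (φ := fun q => (K q.1.2 q.2 : ℝ≥0∞)) ((hN.marg.measurable t ht).comp measurable_fst)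
    (fun p => hN.marg.finite t ht p.1) ?_
  exact (hN.kernel_measurable.comp
    ((measurable_snd.comp measurable_fst).prodMk measurable_snd)).coe_nnreal_ennreal

lemma measurable_shotNoise_section (hN : IsSNMARG1 P H β c κ K ℓ W N) {t : ℕ} (ht : 1 ≤ t)
    (ω : Ω) : Measurable (shotNoise K (W t ω)) :=
  (hN.measurable_shotNoise ht).comp measurable_prodMk_left

lemma measurable_intensityMeasure [SFinite ℓ] (hN : IsSNMARG1 P H β c κ K ℓ W N) {t : ℕ} (ht : 1 ≤ t)
    {B : Set Y} (hB : MeasurableSet B) :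
    Measurable fun ω => intensityMeasure K ℓ (κ t) (W t ω) B := by
  simp only [intensityMeasure_apply _ _ hB]
  exact Measurable.lintegral_prod_right' ((hN.measurable_shotNoise ht).const_mul _)

end IsSNMARG1

/-! ### Mean measures, localisation and covariance. -/

lemma lintegral_meanMeasure {Ω Θ : Type*} [MeasurableSpace Ω] [MeasurableSpace Θ] {P : Measure Ω}
    {w : Ω → Measure Θ} (hw : Measurable w) {f : Θ → ℝ≥0∞} (hf : Measurable f) :
    ∫⁻ θ, f θ ∂meanMeasure P w = ∫⁻ ω, ∫⁻ θ, f θ ∂w ω ∂P :=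
  Measure.lintegral_bind hw.aemeasurable hf.aemeasurable

lemma FiniteOnBounded.add {E : Type*} [MetricSpace E] [MeasurableSpace E] {μ ν : Measure E}
    (hμ : FiniteOnBounded μ) (hν : FiniteOnBounded ν) : FiniteOnBounded (μ + ν) := fun B hB => by
  rw [Measure.add_apply]
  exact ENNReal.add_lt_top.2 ⟨hμ B hB, hν B hB⟩

lemma ae_of_ae_restrict_bounded {Y : Type*} [MetricSpace Y] [MeasurableSpace Y]
    [OpensMeasurableSpace Y] {ℓ : Measure Y} {p : Y → Prop}
    (h : ∀ B, MeasurableSet B → Bornology.IsBounded B → ∀ᵐ y ∂ℓ.restrict B, p y) :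
    ∀ᵐ y ∂ℓ, p y := by
  obtain ⟨S, hS, hSb, hSe⟩ := exists_exhaustion Y
  have h' : ∀ᵐ y ∂ℓ, ∀ n, y ∈ S n → p y :=
    ae_all_iff.2 fun n => (ae_restrict_iff' (hS n)).1 (h _ (hS n) (hSb n))
  filter_upwards [h'] with y hy
  obtain ⟨n, hn⟩ := (hSe y).exists
  exact hy n hn

lemma ae_prod_of_ae_restrict_bounded {Y : Type*} [MetricSpace Y] [MeasurableSpace Y]
    [OpensMeasurableSpace Y] {ℓ : Measure Y} {p : Y × Y → Prop}
    (h : ∀ B, MeasurableSet B → Bornology.IsBounded B →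
      ∀ᵐ y ∂(ℓ.prod ℓ).restrict (B ×ˢ B), p y) :
    ∀ᵐ y ∂ℓ.prod ℓ, p y := by
  obtain ⟨S, hS, hSb, hSe⟩ := exists_exhaustion Y
  have h' : ∀ᵐ y ∂ℓ.prod ℓ, ∀ n, y ∈ S n ×ˢ S n → p y :=
    ae_all_iff.2 fun n => (ae_restrict_iff' ((hS n).prod (hS n))).1 (h _ (hS n) (hSb n))
  filter_upwards [h'] with y hy
  obtain ⟨n, hn⟩ := ((hSe y.1).and (hSe y.2)).exists
  exact hy n hn

lemma integral_coe_eq_toReal {Θ : Type*} [MeasurableSpace Θ] {f : Θ → ℝ≥0} (hf : Measurable f)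
    (w : Measure Θ) : ∫ θ, (f θ : ℝ) ∂w = (∫⁻ θ, (f θ : ℝ≥0∞) ∂w).toReal := by
  rw [integral_eq_lintegral_of_nonneg_ae (Eventually.of_forall fun θ => NNReal.coe_nonneg _)
    (by fun_prop)]
  simp

/-- The covariance of two nonnegative variables with finite means and finite mean product. -/
lemma covariance_toReal {Ω : Type*} [MeasurableSpace Ω] {P : Measure Ω} [IsProbabilityMeasure P]
    {X Y : Ω → ℝ≥0∞} (hX : Measurable X) (hY : Measurable Y) (iX : ∫⁻ ω, X ω ∂P ≠ ∞)
    (iY : ∫⁻ ω, Y ω ∂P ≠ ∞) (iXY : ∫⁻ ω, X ω * Y ω ∂P ≠ ∞) :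
    cov[fun ω => (X ω).toReal, fun ω => (Y ω).toReal; P]
      = (∫⁻ ω, X ω * Y ω ∂P).toReal - (∫⁻ ω, X ω ∂P).toReal * (∫⁻ ω, Y ω ∂P).toReal := by
  have rX := integrable_toReal_of_lintegral_ne_top hX.aemeasurable iX
  have rY := integrable_toReal_of_lintegral_ne_top hY.aemeasurable iY
  have rXY := integrable_toReal_of_lintegral_ne_top (hX.mul hY).aemeasurable iXY
  -- A finite mean makes X finite almost surely, so the value 0 of `toReal` at ∞ does not affect the
  -- integral.
  have eX := integral_toReal hX.aemeasurable (ae_lt_top hX iX)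
  have eY := integral_toReal hY.aemeasurable (ae_lt_top hY iY)
  have eXY := integral_toReal (hX.mul hY).aemeasurable (ae_lt_top (hX.mul hY) iXY)
  simp only [Pi.mul_apply, ENNReal.toReal_mul] at rXY eXY
  rw [covariance, eX, eY]
  set a := (∫⁻ ω, X ω ∂P).toReal
  set b := (∫⁻ ω, Y ω ∂P).toReal
  have e : ∀ ω, ((X ω).toReal - a) * ((Y ω).toReal - b)
      = (X ω).toReal * (Y ω).toReal - b * (X ω).toReal - (a * (Y ω).toReal - a * b) :=
    fun ω => by ring
  simp only [e]
  have i1 : Integrable (fun ω => (X ω).toReal * (Y ω).toReal - b * (X ω).toReal) P :=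
    rXY.sub (rX.const_mul b)
  have i2 : Integrable (fun ω => a * (Y ω).toReal - a * b) P :=
    (rY.const_mul a).sub (integrable_const _)
  rw [integral_sub i1 i2, integral_sub rXY (rX.const_mul b),
    integral_sub (rY.const_mul a) (integrable_const _), integral_const_mul, integral_const_mul,
    eX, eY, eXY]
  simp [mul_comm b a]

/-! ### Closed forms of the densities in [0, ∞]. -/

namespace IsSNMARG1

variable {Ω Y Θ : Type*} [mΩ : MeasurableSpace Ω] [MetricSpace Y] [MeasurableSpace Y]
  [MetricSpace Θ] [MeasurableSpace Θ] [OpensMeasurableSpace Θ]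
  {P : Measure Ω} {H : Measure Θ} {β c κ : ℕ → ℝ≥0} {K : Y → Θ → ℝ≥0}
  {ℓ : Measure Y} {W : ℕ → Ω → Measure Θ} {N : ℕ → Ω → Measure Y}

lemma measurable_shotNoise_mul (hN : IsSNMARG1 P H β c κ K ℓ W N) {s t : ℕ} (hs : 1 ≤ s)
    (ht : 1 ≤ t) : Measurable fun q : Ω × Y × Y =>
      shotNoise K (W s q.1) q.2.1 * shotNoise K (W t q.1) q.2.2 :=
  ((hN.measurable_shotNoise hs).comp (measurable_fst.prodMk (measurable_fst.comp measurable_snd))).mul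
    ((hN.measurable_shotNoise ht).comp
      (measurable_fst.prodMk (measurable_snd.comp measurable_snd)))

lemma measurable_shotNoise_const (hN : IsSNMARG1 P H β c κ K ℓ W N) {w : Measure Θ}
    (hw : FiniteOnBounded w) : Measurable (shotNoise K w) :=
  measurable_lintegral_of_finiteOnBounded (V := fun _ => w)
    (φ := fun q : Y × Θ => (K q.1 q.2 : ℝ≥0∞)) measurable_const (fun _ => hw)
    hN.kernel_measurable.coe_nnreal_ennreal

lemma measurable_lintegral_kernel_mul (hN : IsSNMARG1 P H β c κ K ℓ W N) {w : Measure Θ}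
    (hw : FiniteOnBounded w) :
    Measurable fun p : Y × Y => ∫⁻ θ, (K p.1 θ : ℝ≥0∞) * K p.2 θ ∂w :=
  measurable_lintegral_of_finiteOnBounded (V := fun _ => w)
    (φ := fun q : (Y × Y) × Θ => (K q.1.1 q.2 : ℝ≥0∞) * K q.1.2 q.2) measurable_const (fun _ => hw)
    ((hN.kernel_measurable.comp ((measurable_fst.comp measurable_fst).prodMk
      measurable_snd)).coe_nnreal_ennreal.mul (hN.kernel_measurable.comp
        ((measurable_snd.comp measurable_fst).prodMk measurable_snd)).coe_nnreal_ennreal)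

variable [IsProbabilityMeasure P]

lemma density1_eq (hN : IsSNMARG1 P H β c κ K ℓ W N) {t : ℕ} (ht : 1 ≤ t) (y : Y) :
    density1 P κ K W t y = κ t * cLag β c t 1 * ∫⁻ θ, (K y θ : ℝ≥0∞) ∂H
      + κ t * rhoLag β c t 1 * ∫⁻ θ, (K y θ : ℝ≥0∞) ∂meanMeasure P (W 1) := by
  have hK := hN.measurable_kernel_section y
  rw [density1, lintegral_meanMeasure (hN.marg.measurable 1 le_rfl) hK.coe_nnreal_ennreal]
  simp only [shotNoise]
  rw [hN.marg.lintegral_lag hK ht]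
  ring

/-- The regression of W_{t+h} on the past up to t, with multiplier Z = λ_t(y₁). -/
lemma density2_lag (hN : IsSNMARG1 P H β c κ K ℓ W N) {t : ℕ} (ht : 1 ≤ t) (h : ℕ) (y₁ y₂ : Y) :
    density2 P κ K W t (t + h) y₁ y₂
      = κ (t + h) * rhoLag β c (t + h) t * ((κ t)⁻¹ : ℝ≥0) * density2 P κ K W t t y₁ y₂
        + density1 P κ K W t y₁ * (κ (t + h) * cLag β c (t + h) t *
            ∫⁻ θ, (K y₂ θ : ℝ≥0∞) ∂H) := by
  have hZ : Measurable[past W t] fun ω => shotNoise K (W t ω) y₁ :=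
    (measurable_lintegral_coe (hN.measurable_kernel_section y₁)).comp (measurable_past ht le_rfl)
  have key := hN.marg.lintegral_mul_lag ht hZ (hN.measurable_kernel_section y₂)
    (Nat.le_add_right t h)
  simp only [density2, density1]
  -- If κ_t = 0, its inverse is 0 by convention and both densities at time t vanish, so each side is
  -- 0.
  rcases eq_or_ne (κ t) 0 with h0 | h0
  · simp [h0]
  have hinv : (((κ t)⁻¹ : ℝ≥0) : ℝ≥0∞) * κ t = 1 := by
    rw [← ENNReal.coe_mul, inv_mul_cancel₀ h0, ENNReal.coe_one]
  calc _ = (κ t : ℝ≥0∞) * κ (t + h) * (rhoLag β c (t + h) t *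
          ∫⁻ ω, shotNoise K (W t ω) y₁ * shotNoise K (W t ω) y₂ ∂P
        + (∫⁻ ω, shotNoise K (W t ω) y₁ ∂P) *
          (cLag β c (t + h) t * ∫⁻ θ, (K y₂ θ : ℝ≥0∞) ∂H)) := congrArg _ key
    _ = κ (t + h) * rhoLag β c (t + h) t * 1 * (κ t *
          ∫⁻ ω, shotNoise K (W t ω) y₁ * shotNoise K (W t ω) y₂ ∂P)
        + (κ t * ∫⁻ ω, shotNoise K (W t ω) y₁ ∂P) * (κ (t + h) * cLag β c (t + h) t *
            ∫⁻ θ, (K y₂ θ : ℝ≥0∞) ∂H) := by ring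
    _ = _ := by
      rw [← hinv]
      ring

lemma density2_self (hN : IsSNMARG1 P H β c κ K ℓ W N) {t : ℕ} (ht : 1 ≤ t) (y₁ y₂ : Y) :
    density2 P κ K W t t y₁ y₂ = κ t ^ 2 *
      (cLag β c t 1 ^ 2 * (shotNoise K H y₁ * shotNoise K H y₂)
        + cLag β c t 1 * rhoLag β c t 1 *
          (shotNoise K H y₁ * shotNoise K (meanMeasure P (W 1)) y₂
            + shotNoise K (meanMeasure P (W 1)) y₁ * shotNoise K H y₂)
        + rhoLag β c t 1 ^ 2 * ∫⁻ ω, shotNoise K (W 1 ω) y₁ * shotNoise K (W 1 ω) y₂ ∂P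
        + cLag β c t 1 ^ 2 * ∫⁻ θ, (K y₁ θ : ℝ≥0∞) * K y₂ θ ∂H
        + 2 * rhoLag β c t 1 * cLag β c t 1 *
          ∫⁻ θ, (K y₁ θ : ℝ≥0∞) * K y₂ θ ∂meanMeasure P (W 1)) := by
  have hK := hN.measurable_kernel_section
  have hm := fun {f : Θ → ℝ≥0∞} (hf : Measurable f) =>
    lintegral_meanMeasure (P := P) (hN.marg.measurable 1 le_rfl) hf
  simp only [density2, shotNoise]
  rw [hN.marg.lintegral_mul_self (hK y₁) (hK y₂) ht, hm (hK y₁).coe_nnreal_ennreal,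
    hm (hK y₂).coe_nnreal_ennreal,
    hm ((hK y₁).coe_nnreal_ennreal.fun_mul (hK y₂).coe_nnreal_ennreal), ← sq]

lemma measurable_density1 (hN : IsSNMARG1 P H β c κ K ℓ W N) {t : ℕ} (ht : 1 ≤ t) :
    Measurable (density1 P κ K W t) :=
  (Measurable.lintegral_prod_left' (hN.measurable_shotNoise ht)).const_mul _

lemma measurable_density2 (hN : IsSNMARG1 P H β c κ K ℓ W N) {s t : ℕ} (hs : 1 ≤ s)
    (ht : 1 ≤ t) : Measurable (Function.uncurry (density2 P κ K W s t)) :=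
  (Measurable.lintegral_prod_left' (hN.measurable_shotNoise_mul hs ht)).const_mul _

/-! ### Moments of the counts in terms of the densities. -/

section Moments

variable [SigmaFinite ℓ]

lemma lintegral_intensityMeasure (hN : IsSNMARG1 P H β c κ K ℓ W N) {t : ℕ} (ht : 1 ≤ t)
    {B : Set Y} (hB : MeasurableSet B) :
    ∫⁻ ω, intensityMeasure K ℓ (κ t) (W t ω) B ∂P = ∫⁻ y in B, density1 P κ K W t y ∂ℓ := by
  have hm := hN.measurable_shotNoise ht
  simp only [intensityMeasure_apply _ _ hB]
  rw [lintegral_lintegral_swap (hm.const_mul _).aemeasurable]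
  refine lintegral_congr fun y => ?_
  exact lintegral_const_mul _ (hm.comp measurable_prodMk_right)

lemma lintegral_intensityMeasure_mul (hN : IsSNMARG1 P H β c κ K ℓ W N) {s t : ℕ} (hs : 1 ≤ s)
    (ht : 1 ≤ t) {B₁ B₂ : Set Y} (hB₁ : MeasurableSet B₁) (hB₂ : MeasurableSet B₂) :
    ∫⁻ ω, intensityMeasure K ℓ (κ s) (W s ω) B₁ * intensityMeasure K ℓ (κ t) (W t ω) B₂ ∂P
      = ∫⁻ p in B₁ ×ˢ B₂, density2 P κ K W s t p.1 p.2 ∂(ℓ.prod ℓ) := by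
  have hm := hN.measurable_shotNoise_mul hs ht
  have e : ∀ ω, intensityMeasure K ℓ (κ s) (W s ω) B₁ * intensityMeasure K ℓ (κ t) (W t ω) B₂
      = ∫⁻ p in B₁ ×ˢ B₂, κ s * κ t * (shotNoise K (W s ω) p.1 * shotNoise K (W t ω) p.2)
        ∂(ℓ.prod ℓ) := fun ω => by
    rw [intensityMeasure_apply _ _ hB₁, intensityMeasure_apply _ _ hB₂, ← Measure.prod_restrict,
      ← lintegral_prod_mul ((hN.measurable_shotNoise_section hs ω).const_mul _).aemeasurable
        ((hN.measurable_shotNoise_section ht ω).const_mul _).aemeasurable]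
    refine lintegral_congr fun p => ?_
    ring
  simp only [e]
  rw [lintegral_lintegral_swap (hm.const_mul _).aemeasurable]
  refine lintegral_congr fun p => ?_
  exact lintegral_const_mul _ (hm.comp measurable_prodMk_right)

lemma lintegral_count (hN : IsSNMARG1 P H β c κ K ℓ W N) {t : ℕ} (ht : 1 ≤ t) {B : Set Y}
    (hB : MeasurableSet B) (hb : Bornology.IsBounded B)
    (hfin : ∫⁻ y in B, density1 P κ K W t y ∂ℓ ≠ ∞) :
    ∫⁻ ω, N t ω B ∂P = ∫⁻ y in B, density1 P κ K W t y ∂ℓ := by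
  have hm := hN.measurable_intensityMeasure ht hB
  rw [← hN.lintegral_intensityMeasure ht hB] at hfin ⊢
  have hae := (ae_lt_top hm hfin).mono fun ω hω => hω.ne
  have := lintegral_comp_of_poisson ((Measure.measurable_coe hB).comp (hN.measurable t ht)) hm hae
    (hN.measure_count_one ht hB hb) id
  refine this.trans (lintegral_congr_ae (hae.mono fun ω hω => ?_))
  exact tsum_mul_poissonWeight hω

lemma lintegral_count_sq (hN : IsSNMARG1 P H β c κ K ℓ W N) {t : ℕ} (ht : 1 ≤ t) {B : Set Y}
    (hB : MeasurableSet B) (hb : Bornology.IsBounded B)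
    (hfin : ∫⁻ y in B, density1 P κ K W t y ∂ℓ ≠ ∞) :
    ∫⁻ ω, N t ω B * N t ω B ∂P = ∫⁻ ω, (intensityMeasure K ℓ (κ t) (W t ω) B *
      intensityMeasure K ℓ (κ t) (W t ω) B + intensityMeasure K ℓ (κ t) (W t ω) B) ∂P := by
  have hm := hN.measurable_intensityMeasure ht hB
  rw [← hN.lintegral_intensityMeasure ht hB] at hfin
  have hae := (ae_lt_top hm hfin).mono fun ω hω => hω.ne
  have := lintegral_comp_of_poisson ((Measure.measurable_coe hB).comp (hN.measurable t ht)) hm hae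
    (hN.measure_count_one ht hB hb) fun x => x * x
  refine this.trans (lintegral_congr_ae (hae.mono fun ω hω => ?_))
  exact tsum_sq_mul_poissonWeight hω

lemma lintegral_count_mul (hN : IsSNMARG1 P H β c κ K ℓ W N) {s t : ℕ} (hs : 1 ≤ s) (ht : 1 ≤ t)
    {B₁ B₂ : Set Y} (hB₁ : MeasurableSet B₁) (hb₁ : Bornology.IsBounded B₁)
    (hB₂ : MeasurableSet B₂) (hb₂ : Bornology.IsBounded B₂) (hd : s = t → Disjoint B₁ B₂)
    (hfin₁ : ∫⁻ y in B₁, density1 P κ K W s y ∂ℓ ≠ ∞)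
    (hfin₂ : ∫⁻ y in B₂, density1 P κ K W t y ∂ℓ ≠ ∞) :
    ∫⁻ ω, N s ω B₁ * N t ω B₂ ∂P = ∫⁻ ω, intensityMeasure K ℓ (κ s) (W s ω) B₁ *
      intensityMeasure K ℓ (κ t) (W t ω) B₂ ∂P := by
  have hm₁ := hN.measurable_intensityMeasure hs hB₁
  have hm₂ := hN.measurable_intensityMeasure ht hB₂
  rw [← hN.lintegral_intensityMeasure hs hB₁] at hfin₁
  rw [← hN.lintegral_intensityMeasure ht hB₂] at hfin₂
  exact lintegral_mul_of_poisson ((Measure.measurable_coe hB₁).comp (hN.measurable s hs))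
    ((Measure.measurable_coe hB₂).comp (hN.measurable t ht)) hm₁ hm₂
    ((ae_lt_top hm₁ hfin₁).mono fun ω hω => hω.ne) ((ae_lt_top hm₂ hfin₂).mono fun ω hω => hω.ne)
    (hN.measure_count_one hs hB₁ hb₁) (hN.measure_count_one ht hB₂ hb₂)
    (hN.measure_count_two hs ht hB₁ hb₁ hB₂ hb₂ hd)

/-- Second moments of the counts at a given time. -/
lemma lintegral_count_mul_self (hN : IsSNMARG1 P H β c κ K ℓ W N) {t : ℕ} (ht : 1 ≤ t)
    {B₁ B₂ : Set Y} (hB₁ : MeasurableSet B₁) (hb₁ : Bornology.IsBounded B₁)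
    (hB₂ : MeasurableSet B₂) (hb₂ : Bornology.IsBounded B₂)
    (hfin₁ : ∫⁻ y in B₁, density1 P κ K W t y ∂ℓ ≠ ∞)
    (hfin₂ : ∫⁻ y in B₂, density1 P κ K W t y ∂ℓ ≠ ∞) :
    ∫⁻ ω, N t ω B₁ * N t ω B₂ ∂P = ∫⁻ y in B₁ ∩ B₂, density1 P κ K W t y ∂ℓ
      + ∫⁻ p in B₁ ×ˢ B₂, density2 P κ K W t t p.1 p.2 ∂(ℓ.prod ℓ) := by
  have mono : ∀ {A B : Set Y}, A ⊆ B → ∫⁻ y in B, density1 P κ K W t y ∂ℓ ≠ ∞ →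
      ∫⁻ y in A, density1 P κ K W t y ∂ℓ ≠ ∞ := fun hAB hB =>
    ne_top_of_le_ne_top hB (lintegral_mono_set hAB)
  have hC := hB₁.inter hB₂
  have hD₁ := hB₁.diff hB₂
  have hD₂ := hB₂.diff hB₁
  have bC := hb₁.subset (Set.inter_subset_left (t := B₂))
  have bD₁ := hb₁.subset (Set.sdiff_subset (t := B₂))
  have bD₂ := hb₂.subset (Set.sdiff_subset (t := B₁))
  have fC := mono (Set.inter_subset_left (t := B₂)) hfin₁
  have fD₁ := mono (Set.sdiff_subset (t := B₂)) hfin₁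
  have fD₂ := mono (Set.sdiff_subset (t := B₁)) hfin₂
  -- Independence is available for disjoint sets only. After the split, the square of the overlap is
  -- the single non-independent product, and its Poisson excess m yields the integral over B₁ ∩ B₂.
  have split : ∀ μ : Measure Y, μ B₁ * μ B₂ = μ (B₁ \ B₂) * μ (B₂ \ B₁) + μ (B₁ \ B₂) * μ (B₁ ∩ B₂)
      + μ (B₁ ∩ B₂) * μ (B₂ \ B₁) + μ (B₁ ∩ B₂) * μ (B₁ ∩ B₂) := fun μ => by
    rw [← measure_sdiff_add_inter B₁ hB₂ (μ := μ), ← measure_sdiff_add_inter B₂ hB₁ (μ := μ),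
      Set.inter_comm B₂ B₁]
    ring
  have mN : ∀ {B : Set Y}, MeasurableSet B → Measurable fun ω => N t ω B := fun hB =>
    (Measure.measurable_coe hB).comp (hN.measurable t ht)
  have mI : ∀ {B : Set Y}, MeasurableSet B →
      Measurable fun ω => intensityMeasure K ℓ (κ t) (W t ω) B := fun hB =>
    hN.measurable_intensityMeasure ht hB
  rw [← hN.lintegral_intensityMeasure_mul ht ht hB₁ hB₂, ← hN.lintegral_intensityMeasure ht hC]
  simp only [split]
  rw [lintegral_add_right _ ((mN hC).fun_mul (mN hC)), lintegral_add_right _ ((mN hC).fun_mul (mN hD₂)),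
    lintegral_add_right _ ((mN hD₁).fun_mul (mN hC)), lintegral_add_right _ ((mI hC).fun_mul (mI hC)),
    lintegral_add_right _ ((mI hC).fun_mul (mI hD₂)), lintegral_add_right _ ((mI hD₁).fun_mul (mI hC)),
    hN.lintegral_count_sq ht hC bC fC, lintegral_add_right _ (mI hC),
    hN.lintegral_count_mul ht ht hD₁ bD₁ hD₂ bD₂ (fun _ => Set.disjoint_left.2
      fun y h1 h2 => h1.2 h2.1) fD₁ fD₂,
    hN.lintegral_count_mul ht ht hD₁ bD₁ hC bC (fun _ => Set.disjoint_left.2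
      fun y h1 h2 => h1.2 h2.2) fD₁ fC,
    hN.lintegral_count_mul ht ht hC bC hD₂ bD₂ (fun _ => Set.disjoint_left.2
      fun y h1 h2 => h2.2 h1.1) fC fD₂]
  ring

end Moments

end IsSNMARG1

lemma shotNoise_add_measure {Y Θ : Type*} [MeasurableSpace Θ] (K : Y → Θ → ℝ≥0) (μ ν : Measure Θ)
    (y : Y) : shotNoise K (μ + ν) y = shotNoise K μ y + shotNoise K ν y :=
  lintegral_add_measure _ _ _

/-! ### Finiteness, almost everywhere convergence and the covariance formula. -/

namespace IsSNMARG1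

variable {Ω Y Θ : Type*} [mΩ : MeasurableSpace Ω] [MetricSpace Y] [MeasurableSpace Y]
  [MetricSpace Θ] [MeasurableSpace Θ] [OpensMeasurableSpace Θ]
  {P : Measure Ω} [IsProbabilityMeasure P] {H : Measure Θ} {β c κ : ℕ → ℝ≥0} {K : Y → Θ → ℝ≥0}
  {ℓ : Measure Y} {W : ℕ → Ω → Measure Θ} {N : ℕ → Ω → Measure Y}

lemma density1_le (hN : IsSNMARG1 P H β c κ K ℓ W N) {t : ℕ} (ht : 1 ≤ t) (y : Y) :
    density1 P κ K W t y ≤ (κ t * cLag β c t 1 + κ t * rhoLag β c t 1) *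
      shotNoise K (H + meanMeasure P (W 1)) y := by
  rw [hN.density1_eq ht, add_mul, shotNoise_add_measure]
  gcongr
  · exact le_self_add
  · exact le_add_self

lemma lintegral_density1_lt_top (hN : IsSNMARG1 P H β c κ K ℓ W N) {t : ℕ} (ht : 1 ≤ t) {B : Set Y}
    (hB : ∫⁻ y in B, shotNoise K (H + meanMeasure P (W 1)) y ∂ℓ < ∞) :
    ∫⁻ y in B, density1 P κ K W t y ∂ℓ < ∞ := by
  refine (lintegral_mono fun y => hN.density1_le ht y).trans_lt ?_
  rw [lintegral_const_mul' _ _ (by finiteness)]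
  exact ENNReal.mul_lt_top (by finiteness) hB

/-- Each separate integral against H or W̄₁ is bounded by the one against H + W̄₁, the form in which
the hypotheses are stated. The two cross products share one bound, hence the factor 2. -/
lemma density2_self_le (hN : IsSNMARG1 P H β c κ K ℓ W N) {t : ℕ} (ht : 1 ≤ t) (y₁ y₂ : Y) :
    density2 P κ K W t t y₁ y₂ ≤ κ t ^ 2 *
      (((cLag β c t 1 ^ 2 + 2 * (cLag β c t 1 * rhoLag β c t 1)) *
          (shotNoise K (H + meanMeasure P (W 1)) y₁ * shotNoise K (H + meanMeasure P (W 1)) y₂)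
        + rhoLag β c t 1 ^ 2 * ∫⁻ ω, shotNoise K (W 1 ω) y₁ * shotNoise K (W 1 ω) y₂ ∂P)
        + (cLag β c t 1 ^ 2 + 2 * rhoLag β c t 1 * cLag β c t 1) *
          ∫⁻ θ, (K y₁ θ : ℝ≥0∞) * K y₂ θ ∂(H + meanMeasure P (W 1))) := by
  have hH : ∀ y, shotNoise K H y ≤ shotNoise K (H + meanMeasure P (W 1)) y := fun y => by
    rw [shotNoise_add_measure]
    exact le_self_add
  have hM : ∀ y, shotNoise K (meanMeasure P (W 1)) y
      ≤ shotNoise K (H + meanMeasure P (W 1)) y := fun y => by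
    rw [shotNoise_add_measure]
    exact le_add_self
  have uH : ∫⁻ θ, (K y₁ θ : ℝ≥0∞) * K y₂ θ ∂H
      ≤ ∫⁻ θ, (K y₁ θ : ℝ≥0∞) * K y₂ θ ∂(H + meanMeasure P (W 1)) :=
    lintegral_mono' (Measure.le_add_right le_rfl) le_rfl
  have uM : ∫⁻ θ, (K y₁ θ : ℝ≥0∞) * K y₂ θ ∂meanMeasure P (W 1)
      ≤ ∫⁻ θ, (K y₁ θ : ℝ≥0∞) * K y₂ θ ∂(H + meanMeasure P (W 1)) :=
    lintegral_mono' (Measure.le_add_left le_rfl) le_rfl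
  rw [hN.density2_self ht]
  refine mul_le_mul_right ?_ _
  have h1 := mul_le_mul' (hH y₁) (hH y₂)
  have h2 := mul_le_mul' (hH y₁) (hM y₂)
  have h3 := mul_le_mul' (hM y₁) (hH y₂)
  refine (add_le_add (add_le_add (add_le_add (add_le_add (mul_le_mul_right h1 _)
    (mul_le_mul_right (add_le_add h2 h3) _)) le_rfl) (mul_le_mul_right uH _))
    (mul_le_mul_right uM _)).trans (le_of_eq ?_)
  ring

/-- The closed form of the second-order product density. -/
lemma toReal_density2_self (hN : IsSNMARG1 P H β c κ K ℓ W N) {t : ℕ} (ht : 1 ≤ t) {y₁ y₂ : Y}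
    (hc : ConvergesAt P H K (W 1) y₁ y₂) :
    density1 P κ K W t y₁ ≠ ∞ ∧ density1 P κ K W t y₂ ≠ ∞ ∧ density2 P κ K W t t y₁ y₂ ≠ ∞ ∧
    (density2 P κ K W t t y₁ y₂).toReal
      = (density1 P κ K W t y₁).toReal * (density1 P κ K W t y₂).toReal
        + (κ t : ℝ) ^ 2 * (cLag β c t 1 : ℝ) ^ 2 * ∫ θ, (K y₁ θ : ℝ) * (K y₂ θ : ℝ) ∂H
        + 2 * (κ t : ℝ) ^ 2 * (rhoLag β c t 1 : ℝ) * (cLag β c t 1 : ℝ) *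
            ∫ θ, (K y₁ θ : ℝ) * (K y₂ θ : ℝ) ∂meanMeasure P (W 1)
        + (κ t : ℝ) ^ 2 * (rhoLag β c t 1 : ℝ) ^ 2 *
            cov[fun ω => ∫ θ, (K y₁ θ : ℝ) ∂(W 1 ω), fun ω => ∫ θ, (K y₂ θ : ℝ) ∂(W 1 ω); P] := by
  have hK := hN.measurable_kernel_section
  obtain ⟨h1, h2, h3, h4⟩ := hc
  rw [shotNoise_add_measure, ENNReal.add_lt_top] at h1 h2
  rw [lintegral_add_measure, ENNReal.add_lt_top] at h3
  have hm := fun y => lintegral_meanMeasure (P := P) (hN.marg.measurable 1 le_rfl)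
    (hK y).coe_nnreal_ennreal
  have mean : ∀ y, ∫⁻ ω, shotNoise K (W 1 ω) y ∂P = shotNoise K (meanMeasure P (W 1)) y :=
    fun y => (hm y).symm
  have mW : ∀ y, Measurable fun ω => shotNoise K (W 1 ω) y := fun y =>
    hN.marg.measurable_lintegral le_rfl (hK y)
  have hcov := covariance_toReal (P := P) (mW y₁) (mW y₂) (by rw [mean]; exact h1.2.ne)
    (by rw [mean]; exact h2.2.ne) h4.ne
  have hprod : ∀ w : Measure Θ, ∫ θ, (K y₁ θ : ℝ) * (K y₂ θ : ℝ) ∂w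
      = (∫⁻ θ, (K y₁ θ : ℝ≥0∞) * K y₂ θ ∂w).toReal := fun w => by
    simpa using integral_coe_eq_toReal ((hK y₁).fun_mul (hK y₂)) w
  have hint : ∀ y, (fun ω => ∫ θ, (K y θ : ℝ) ∂(W 1 ω))
      = fun ω => (shotNoise K (W 1 ω) y).toReal := fun y => by
    funext ω
    exact integral_coe_eq_toReal (hK y) _
  rw [hint, hint, hcov, mean, mean, hprod, hprod, hN.density2_self ht, hN.density1_eq ht,
    hN.density1_eq ht]
  -- The integrals coming from `density1_eq` are refolded into `shotNoise`, so that each quantity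
  -- becomes a single atom. What remains is a polynomial identity in seven finite numbers, in which
  -- the covariance q - b₁b₂ supplies the term missing from the product of the intensities.
  change _ ∧ _ ∧ _ ∧ (_ : ℝ) = (_ * _ * shotNoise K H y₁ + _ * _ * shotNoise K _ y₁).toReal *
    (_ * _ * shotNoise K H y₂ + _ * _ * shotNoise K _ y₂).toReal + _ + _ + _
  change _ * _ * shotNoise K H y₁ + _ * _ * shotNoise K _ y₁ ≠ ∞ ∧
    _ * _ * shotNoise K H y₂ + _ * _ * shotNoise K _ y₂ ≠ ∞ ∧ _
  generalize shotNoise K H y₁ = a₁ at *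
  generalize shotNoise K H y₂ = a₂ at *
  generalize shotNoise K (meanMeasure P (W 1)) y₁ = b₁ at *
  generalize shotNoise K (meanMeasure P (W 1)) y₂ = b₂ at *
  generalize ∫⁻ ω, shotNoise K (W 1 ω) y₁ * shotNoise K (W 1 ω) y₂ ∂P = q at *
  generalize ∫⁻ θ, (K y₁ θ : ℝ≥0∞) * K y₂ θ ∂H = u at *
  generalize ∫⁻ θ, (K y₁ θ : ℝ≥0∞) * K y₂ θ ∂meanMeasure P (W 1) = v at *
  lift a₁ to ℝ≥0 using h1.1.ne
  lift a₂ to ℝ≥0 using h2.1.ne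
  lift b₁ to ℝ≥0 using h1.2.ne
  lift b₂ to ℝ≥0 using h2.2.ne
  lift q to ℝ≥0 using h4.ne
  lift u to ℝ≥0 using h3.1.ne
  lift v to ℝ≥0 using h3.2.ne
  refine ⟨by finiteness, by finiteness, by finiteness, ?_⟩
  norm_cast
  simp only [ENNReal.coe_toReal]
  push_cast
  ring

/-- Finite integrals over bounded squares give almost everywhere finiteness there, and countably
many squares B × B, with B a ball about a fixed centre, cover the product. -/
lemma ae_convergesAt [OpensMeasurableSpace Y] (hN : IsSNMARG1 P H β c κ K ℓ W N)
    (hW : FiniteOnBounded (meanMeasure P (W 1)))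
    (h₁ : ∀ B : Set Y, MeasurableSet B → Bornology.IsBounded B →
      ∫⁻ y in B, shotNoise K (H + meanMeasure P (W 1)) y ∂ℓ < ∞)
    (hprod : ∀ B : Set Y, MeasurableSet B → Bornology.IsBounded B →
      ∫⁻ p in B ×ˢ B, ∫⁻ θ, (K p.1 θ : ℝ≥0∞) * K p.2 θ ∂(H + meanMeasure P (W 1)) ∂(ℓ.prod ℓ) < ∞)
    (hinit : ∀ B : Set Y, MeasurableSet B → Bornology.IsBounded B →
      ∫⁻ p in B ×ˢ B, ∫⁻ ω, shotNoise K (W 1 ω) p.1 * shotNoise K (W 1 ω) p.2 ∂P ∂(ℓ.prod ℓ) < ∞) :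
    ∀ᵐ p ∂(ℓ.prod ℓ), ConvergesAt P H K (W 1) p.1 p.2 := by
  have hfin := hN.marg.base_finite.add hW
  have e1 : ∀ᵐ y ∂ℓ, shotNoise K (H + meanMeasure P (W 1)) y < ∞ :=
    ae_of_ae_restrict_bounded fun B hB hb =>
      ae_lt_top (hN.measurable_shotNoise_const hfin) (h₁ B hB hb).ne
  have e2 := ae_prod_of_ae_restrict_bounded (ℓ := ℓ) fun B hB hb =>
    ae_lt_top (hN.measurable_lintegral_kernel_mul hfin) (hprod B hB hb).ne
  have e3 := ae_prod_of_ae_restrict_bounded (ℓ := ℓ) fun B hB hb =>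
    ae_lt_top (Measurable.lintegral_prod_left'
      (hN.measurable_shotNoise_mul (s := 1) (t := 1) le_rfl le_rfl)) (hinit B hB hb).ne
  filter_upwards [Measure.quasiMeasurePreserving_fst.ae e1,
    Measure.quasiMeasurePreserving_snd.ae e1, e2, e3] with p hp1 hp2 hp3 hp4
  exact ⟨hp1, hp2, hp3, hp4⟩

variable [SigmaFinite ℓ]

lemma lintegral_density2_self_lt_top (hN : IsSNMARG1 P H β c κ K ℓ W N)
    (hW : FiniteOnBounded (meanMeasure P (W 1))) {t : ℕ} (ht : 1 ≤ t) {B₁ B₂ : Set Y}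
    (h₁ : ∫⁻ y in B₁, shotNoise K (H + meanMeasure P (W 1)) y ∂ℓ < ∞)
    (h₂ : ∫⁻ y in B₂, shotNoise K (H + meanMeasure P (W 1)) y ∂ℓ < ∞)
    (hprod : ∫⁻ p in B₁ ×ˢ B₂, ∫⁻ θ, (K p.1 θ : ℝ≥0∞) * K p.2 θ
      ∂(H + meanMeasure P (W 1)) ∂(ℓ.prod ℓ) < ∞)
    (hinit : ∫⁻ p in B₁ ×ˢ B₂, ∫⁻ ω, shotNoise K (W 1 ω) p.1 * shotNoise K (W 1 ω) p.2 ∂P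
      ∂(ℓ.prod ℓ) < ∞) :
    ∫⁻ p in B₁ ×ˢ B₂, density2 P κ K W t t p.1 p.2 ∂(ℓ.prod ℓ) < ∞ := by
  have hfin := hN.marg.base_finite.add hW
  have m1 := hN.measurable_shotNoise_const hfin
  have m2 := hN.measurable_lintegral_kernel_mul hfin
  have mX : Measurable fun p : Y × Y => shotNoise K (H + meanMeasure P (W 1)) p.1 *
      shotNoise K (H + meanMeasure P (W 1)) p.2 :=
    (m1.comp measurable_fst).mul (m1.comp measurable_snd)
  have hX : ∫⁻ p in B₁ ×ˢ B₂, shotNoise K (H + meanMeasure P (W 1)) p.1 *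
      shotNoise K (H + meanMeasure P (W 1)) p.2 ∂(ℓ.prod ℓ) < ∞ := by
    rw [← Measure.prod_restrict, lintegral_prod_mul m1.aemeasurable m1.aemeasurable]
    exact ENNReal.mul_lt_top h₁ h₂
  refine (lintegral_mono fun p : Y × Y => hN.density2_self_le ht p.1 p.2).trans_lt ?_
  rw [lintegral_const_mul' _ _ (by finiteness), lintegral_add_right _ (m2.const_mul _),
    lintegral_add_left (mX.const_mul _), lintegral_const_mul' _ _ (by finiteness),
    lintegral_const_mul' _ _ (by finiteness), lintegral_const_mul' _ _ (by finiteness)]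
  exact ENNReal.mul_lt_top (by finiteness) (ENNReal.add_lt_top.2 ⟨ENNReal.add_lt_top.2
    ⟨ENNReal.mul_lt_top (by finiteness) hX, ENNReal.mul_lt_top (by finiteness) hinit⟩,
    ENNReal.mul_lt_top (by finiteness) hprod⟩)

/-- In the lag formula the second term is a function of y₁ times a function of y₂, so its integral
over B₁ × B₂ factors. -/
lemma lintegral_density2_lag_lt_top (hN : IsSNMARG1 P H β c κ K ℓ W N)
    {t : ℕ} (ht : 1 ≤ t) (h : ℕ) {B₁ B₂ : Set Y}
    (hself : ∫⁻ p in B₁ ×ˢ B₂, density2 P κ K W t t p.1 p.2 ∂(ℓ.prod ℓ) < ∞)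
    (h₁ : ∫⁻ y in B₁, density1 P κ K W t y ∂ℓ < ∞)
    (h₂ : ∫⁻ y in B₂, shotNoise K (H + meanMeasure P (W 1)) y ∂ℓ < ∞) :
    ∫⁻ p in B₁ ×ˢ B₂, density2 P κ K W t (t + h) p.1 p.2 ∂(ℓ.prod ℓ) < ∞ := by
  have m1 := hN.measurable_shotNoise_const hN.marg.base_finite
  have m2 := hN.measurable_density1 ht
  have hH : ∫⁻ y in B₂, shotNoise K H y ∂ℓ < ∞ := by
    refine (lintegral_mono fun y => ?_).trans_lt h₂
    rw [shotNoise_add_measure]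
    exact le_self_add
  have mself : Measurable fun p : Y × Y => density2 P κ K W t t p.1 p.2 :=
    hN.measurable_density2 ht ht
  have mlag : Measurable fun y => κ (t + h) * cLag β c (t + h) t * ∫⁻ θ, (K y θ : ℝ≥0∞) ∂H :=
    m1.const_mul _
  simp only [hN.density2_lag ht h]
  rw [lintegral_add_left (mself.const_mul _), lintegral_const_mul' _ _ (by finiteness),
    ← Measure.prod_restrict,
    lintegral_prod_mul m2.aemeasurable mlag.aemeasurable,
    lintegral_const_mul' _ _ (by finiteness), Measure.prod_restrict]
  exact ENNReal.add_lt_top.2 ⟨ENNReal.mul_lt_top (by finiteness) hself,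
    ENNReal.mul_lt_top h₁ (ENNReal.mul_lt_top (by finiteness) hH)⟩

end IsSNMARG1

end SNMARG

/-! ### Assembly of the result. -/

theorem proposition8
    {Ω Y Θ : Type*} [MeasurableSpace Ω]
    [MetricSpace Y] [PolishSpace Y] [MeasurableSpace Y] [BorelSpace Y]
    [MetricSpace Θ] [PolishSpace Θ] [MeasurableSpace Θ] [BorelSpace Θ]
    (P : Measure Ω) [IsProbabilityMeasure P]
    (H : Measure Θ) (ℓ : Measure Y) [SigmaFinite ℓ]
    (β c κ : ℕ → ℝ≥0) (K : Y → Θ → ℝ≥0)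
    (W : ℕ → Ω → Measure Θ) (N : ℕ → Ω → Measure Y)
    (hN : SNMARG.IsSNMARG1 P H β c κ K ℓ W N)
    (hW1 : SNMARG.FiniteOnBounded (SNMARG.meanMeasure P (W 1)))
    (H1 : ∀ B : Set Y, MeasurableSet B → Bornology.IsBounded B →
      (∀ θ, ∫⁻ y in B, (K y θ : ℝ≥0∞) ∂ℓ < ∞) ∧
      ∫⁻ y in B, ∫⁻ θ, (K y θ : ℝ≥0∞) ∂(H + SNMARG.meanMeasure P (W 1)) ∂ℓ < ∞)
    (H2 : ∀ B₁ B₂ : Set Y, MeasurableSet B₁ → Bornology.IsBounded B₁ →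
      MeasurableSet B₂ → Bornology.IsBounded B₂ →
      ∫⁻ p in B₁ ×ˢ B₂, ∫⁻ θ, (K p.1 θ : ℝ≥0∞) * K p.2 θ
        ∂(H + SNMARG.meanMeasure P (W 1)) ∂(ℓ.prod ℓ) < ∞)
    (H3 : ∀ B₁ B₂ : Set Y, MeasurableSet B₁ → Bornology.IsBounded B₁ →
      MeasurableSet B₂ → Bornology.IsBounded B₂ →
      ∫⁻ ω, ∫⁻ p in B₁ ×ˢ B₂, (∫⁻ θ₁, (K p.1 θ₁ : ℝ≥0∞) ∂(W 1 ω)) *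
        (∫⁻ θ₂, (K p.2 θ₂ : ℝ≥0∞) ∂(W 1 ω)) ∂(ℓ.prod ℓ) ∂P < ∞) :
    ∀ t h : ℕ, 1 ≤ t → 1 ≤ h →
      -- the three functions are the densities of the process `N`
      (SNMARG.IsIntensity P ℓ (N t) (SNMARG.density1 P κ K W t) ∧
       SNMARG.IsSecondOrderProductDensity P ℓ (N t)
          (SNMARG.density1 P κ K W t) (SNMARG.density2 P κ K W t t) ∧
       SNMARG.IsCrossSecondOrderDensity P ℓ (N t) (N (t + h))
          (SNMARG.density2 P κ K W t (t + h))) ∧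
      -- the intensity
      (∀ y, SNMARG.density1 P κ K W t y
        = κ t * SNMARG.cLag β c t 1 * ∫⁻ θ, (K y θ : ℝ≥0∞) ∂H
          + κ t * SNMARG.rhoLag β c t 1 *
              ∫⁻ θ, (K y θ : ℝ≥0∞) ∂(SNMARG.meanMeasure P (W 1))) ∧
      -- the cross second-order density
      (∀ y₁ y₂, SNMARG.density2 P κ K W t (t + h) y₁ y₂
        = κ (t + h) * SNMARG.rhoLag β c (t + h) t * ((κ t)⁻¹ : ℝ≥0) *
              SNMARG.density2 P κ K W t t y₁ y₂
          + SNMARG.density1 P κ K W t y₁ * (κ (t + h) * SNMARG.cLag β c (t + h) t *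
              ∫⁻ θ, (K y₂ θ : ℝ≥0∞) ∂H)) ∧
      -- the second-order product density
      (∀ᵐ p ∂(ℓ.prod ℓ), SNMARG.ConvergesAt P H K (W 1) p.1 p.2) ∧
      (∀ y₁ y₂, SNMARG.ConvergesAt P H K (W 1) y₁ y₂ →
        SNMARG.density1 P κ K W t y₁ ≠ ∞ ∧ SNMARG.density1 P κ K W t y₂ ≠ ∞ ∧
        SNMARG.density2 P κ K W t t y₁ y₂ ≠ ∞ ∧
        (SNMARG.density2 P κ K W t t y₁ y₂).toReal
          = (SNMARG.density1 P κ K W t y₁).toReal * (SNMARG.density1 P κ K W t y₂).toReal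
            + (κ t : ℝ) ^ 2 * (SNMARG.cLag β c t 1 : ℝ) ^ 2 *
                ∫ θ, (K y₁ θ : ℝ) * (K y₂ θ : ℝ) ∂H
            + 2 * (κ t : ℝ) ^ 2 * (SNMARG.rhoLag β c t 1 : ℝ) * (SNMARG.cLag β c t 1 : ℝ) *
                ∫ θ, (K y₁ θ : ℝ) * (K y₂ θ : ℝ) ∂(SNMARG.meanMeasure P (W 1))
            + (κ t : ℝ) ^ 2 * (SNMARG.rhoLag β c t 1 : ℝ) ^ 2 *
                cov[fun ω => ∫ θ, (K y₁ θ : ℝ) ∂(W 1 ω),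
                  fun ω => ∫ θ, (K y₂ θ : ℝ) ∂(W 1 ω); P]) := by
  intro t h ht hh
  have hA : ∀ B : Set Y, MeasurableSet B → Bornology.IsBounded B →
      ∫⁻ y in B, SNMARG.shotNoise K (H + SNMARG.meanMeasure P (W 1)) y ∂ℓ < ∞ :=
    fun B hB hb => (H1 B hB hb).2
  have hinit : ∀ B₁ B₂ : Set Y, MeasurableSet B₁ → Bornology.IsBounded B₁ →
      MeasurableSet B₂ → Bornology.IsBounded B₂ →
      ∫⁻ p in B₁ ×ˢ B₂, ∫⁻ ω, SNMARG.shotNoise K (W 1 ω) p.1 * SNMARG.shotNoise K (W 1 ω) p.2 ∂P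
        ∂(ℓ.prod ℓ) < ∞ := fun B₁ B₂ hB₁ hb₁ hB₂ hb₂ => by
    -- The third moment hypothesis integrates over ω last; Tonelli moves that integral inside.
    rw [← lintegral_lintegral_swap
      (hN.measurable_shotNoise_mul (s := 1) (t := 1) le_rfl le_rfl).aemeasurable]
    exact H3 B₁ B₂ hB₁ hb₁ hB₂ hb₂
  have hD1 : ∀ {s : ℕ}, 1 ≤ s → ∀ B : Set Y, MeasurableSet B → Bornology.IsBounded B →
      ∫⁻ y in B, SNMARG.density1 P κ K W s y ∂ℓ < ∞ :=
    fun hs B hB hb => hN.lintegral_density1_lt_top hs (hA B hB hb)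
  have hD2 : ∀ B₁ B₂ : Set Y, MeasurableSet B₁ → Bornology.IsBounded B₁ →
      MeasurableSet B₂ → Bornology.IsBounded B₂ →
      ∫⁻ p in B₁ ×ˢ B₂, SNMARG.density2 P κ K W t t p.1 p.2 ∂(ℓ.prod ℓ) < ∞ :=
    fun B₁ B₂ hB₁ hb₁ hB₂ hb₂ => hN.lintegral_density2_self_lt_top hW1 ht (hA B₁ hB₁ hb₁)
      (hA B₂ hB₂ hb₂) (H2 B₁ B₂ hB₁ hb₁ hB₂ hb₂) (hinit B₁ B₂ hB₁ hb₁ hB₂ hb₂)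
  have hth : 1 ≤ t + h := by omega
  refine ⟨⟨⟨hN.measurable_density1 ht, hD1 ht, fun B hB hb =>
      hN.lintegral_count ht hB hb (hD1 ht B hB hb).ne⟩,
    ⟨hN.measurable_density2 ht ht, hD2, fun B₁ B₂ hB₁ hb₁ hB₂ hb₂ =>
      hN.lintegral_count_mul_self ht hB₁ hb₁ hB₂ hb₂ (hD1 ht B₁ hB₁ hb₁).ne
        (hD1 ht B₂ hB₂ hb₂).ne⟩,
    ⟨hN.measurable_density2 ht hth, fun B₁ B₂ hB₁ hb₁ hB₂ hb₂ =>
      hN.lintegral_density2_lag_lt_top ht h (hD2 B₁ B₂ hB₁ hb₁ hB₂ hb₂) (hD1 ht B₁ hB₁ hb₁)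
        (hA B₂ hB₂ hb₂), fun B₁ B₂ hB₁ hb₁ hB₂ hb₂ => ?_⟩⟩,
    hN.density1_eq ht, hN.density2_lag ht h, ?_, fun y₁ y₂ => hN.toReal_density2_self ht⟩
  -- Since h ≥ 1 the two times differ, so B₁ and B₂ need not be disjoint and no diagonal term
  -- appears.
  · rw [hN.lintegral_count_mul ht hth hB₁ hb₁ hB₂ hb₂ (fun e => by omega)
      (hD1 ht B₁ hB₁ hb₁).ne (hD1 hth B₂ hB₂ hb₂).ne,
      hN.lintegral_intensityMeasure_mul ht hth hB₁ hB₂]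
  · exact hN.ae_convergesAt hW1 hA (fun B hB hb => H2 B B hB hb hB hb)
      fun B hB hb => hinit B B hB hb hB hb
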